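/- Let $a,b,c,d$ be nonnegative integers with $a+b=c+d=:S$ and $bc\neq 0$; put $m=a-c$ and $\sigma=m/S$, and assume $\sigma>\tfrac12$. Consider the two-color Pólya urn in discrete time with replacement matrix $R=\begin{pmatrix}a&b\\c&d\end{pmatrix}$: at each step a ball is drawn uniformly from the urn and put back, together with $a$ red and $b$ black balls if it is red, and with $c$ red and $d$ black balls if it is black. For $(\alpha,\beta)\in\mathbb N^2\setminus\{(0,0)\}$ let $U_{(\alpha,\beta)}(n)=(x_n,y_n)$ be the composition vector (numbers of red and of black balls) at time $n$ of the urn that starts with $\alpha$ red and $\beta$ black balls, and let $u_2(x,y)=\frac1S(bx-cy)$. (1) For every $(\alpha,\beta)\in\mathbb N^2\setminus\{(0,0)\}$ the real limit $$W_{(\alpha,\beta)}=\lim_{n\to\infty}\frac{1}{n^{\sigma}}\,u_2\big(U_{(\alpha,\beta)}(n)\big)$$ exists almost surely. (2) For every $(\alpha,\beta)\in\mathbb N^2\setminus\{(0,0)\}$, $$W_{(\alpha,\beta)}\ \overset{\mathcal L}{=}\ \sum_{k=1}^{\alpha}Z_k^{\sigma}\,W_{(1,0)}^{(k)}+\sum_{k=\alpha+1}^{\alpha+\beta}Z_k^{\sigma}\,W_{(0,1)}^{(k)},$$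 where $Z=(Z_1,\dots,Z_{\alpha+\beta})$ is a Dirichlet distributed random vector with parameters $(\frac1S,\dots,\frac1S)$ (when $\alpha+\beta=1$, this means $Z_1=1$ almost surely), the random variables $W_{(1,0)}^{(k)}$ and $W_{(0,1)}^{(k)}$ are copies of $W_{(1,0)}$ and of $W_{(0,1)}$ respectively, and all of them are independent of each other and of $Z$. -/

import Mathlib

open MeasureTheory ProbabilityTheory Filter Topology
open scoped ENNReal

noncomputable section

namespace PolyaUrn

/-- The law of the next composition, when an urn with replacement matrix `(a b; c d)` contains `v.1`
red and `v.2` black balls: a ball is drawn uniformly, so it is red with probability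
`v.1 / (v.1 + v.2)` and black with probability `v.2 / (v.1 + v.2)`; it is put back together with
`a` red and `b` black balls in the first case, `c` red and `d` black balls in the second one.
By convention an empty urn stays empty. -/
def stepMeasure (a b c d : ℕ) (v : ℕ × ℕ) : Measure (ℕ × ℕ) :=
  if v = (0, 0) then Measure.dirac v
  else ((v.1 : ℝ≥0∞) / (v.1 + v.2)) • Measure.dirac (v.1 + a, v.2 + b)
    + ((v.2 : ℝ≥0∞) / (v.1 + v.2)) • Measure.dirac (v.1 + c, v.2 + d)

/-- The one-step transition kernel of the urn. -/
def stepKernel (a b c d : ℕ) : Kernel (ℕ × ℕ) (ℕ × ℕ) :=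
  Kernel.ofFunOfCountable (stepMeasure a b c d)

instance (a b c d : ℕ) : IsMarkovKernel (stepKernel a b c d) := by
  refine ⟨fun v => ⟨?_⟩⟩
  change stepMeasure a b c d v Set.univ = 1
  unfold stepMeasure
  split_ifs with h
  · simp
  · simp only [Measure.coe_add, Measure.coe_smul, Pi.add_apply, Pi.smul_apply, measure_univ,
      smul_eq_mul, mul_one]
    rw [← ENNReal.add_div]
    refine ENNReal.div_self ?_ (by finiteness)
    intro h0
    apply h
    ext <;> simp_all

/-- The transition kernel that gives the composition at time `n + 1` from the compositions at the
times `0, …, n`; it depends only on the composition at time `n`. -/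
def historyKernel (a b c d n : ℕ) : Kernel (Finset.Iic n → ℕ × ℕ) (ℕ × ℕ) :=
  (stepKernel a b c d).comap (fun x => x ⟨n, Finset.mem_Iic.2 le_rfl⟩) (measurable_pi_apply _)

instance (a b c d n : ℕ) : IsMarkovKernel (historyKernel a b c d n) := by
  unfold historyKernel
  infer_instance

/-- The law, on the space of sequences of compositions `(red, black)`, of the discrete-time urn
process `(U(n))_{n ≥ 0}` with replacement matrix `(a b; c d)` and initial composition `(α, β)`. -/
def urnLaw (a b c d α β : ℕ) : Measure (ℕ → ℕ × ℕ) :=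
  Kernel.trajMeasure (X := fun _ => ℕ × ℕ) (Measure.dirac (α, β)) (historyKernel a b c d)

/-- The ratio `σ = m / S` of the eigenvalues `m = a - c` and `S = a + b` of the replacement
matrix. -/
def ratio (a b c : ℕ) : ℝ := ((a : ℝ) - c) / ((a : ℝ) + b)

/-- The eigenform `u₂(x, y) = (b x - c y) / S`, where `S = a + b`. -/
def u₂ (a b c : ℕ) (v : ℕ × ℕ) : ℝ := ((b : ℝ) * v.1 - (c : ℝ) * v.2) / ((a : ℝ) + b)

/-- The rescaled second projection `n^(-σ) u₂(U(n))` of a trajectory `U`. -/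
def scaled (a b c : ℕ) (U : ℕ → ℕ × ℕ) (n : ℕ) : ℝ := u₂ a b c (U n) / (n : ℝ) ^ ratio a b c

/-- The law of `W_(α,β) = lim n^(-σ) u₂(U_(α,β)(n))`. (The theorem asserts that this limit exists
almost surely.) -/
def limitLaw (a b c d α β : ℕ) : Measure ℝ :=
  (urnLaw a b c d α β).map (fun U => limUnder atTop (scaled a b c U))

/-- The point `(x₁, …, xₙ, 1 - ∑ xᵢ)` of the hyperplane `∑ xᵢ = 1` over `(x₁, …, xₙ)`. -/
def simplexPoint {n : ℕ} (x : Fin n → ℝ) : Fin (n + 1) → ℝ :=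
  Fin.snoc (α := fun _ => ℝ) x (1 - ∑ i, x i)

open scoped Classical in
/-- The Dirichlet distribution with parameters `ν₁, …, ν_d` (positive reals, `d ≥ 1`): the
probability measure on the simplex with density
`Γ(ν₁ + ⋯ + ν_d) / (Γ(ν₁) ⋯ Γ(ν_d)) * ∏ x_k ^ (ν_k - 1)` with respect to the Lebesgue measure
`dx₁ ⋯ dx_{d-1}`. For `d = 1` this is the Dirac mass at the point `1`. There is no Dirichlet
distribution for `d = 0`, where the value is the zero measure. -/
def dirichlet : (d : ℕ) → (Fin d → ℝ) → Measure (Fin d → ℝ)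
  | 0, _ => 0
  | n + 1, ν =>
    ((volume : Measure (Fin n → ℝ)).withDensity fun x =>
      if (∀ i, 0 ≤ x i) ∧ ∑ i, x i ≤ 1 then
        ENNReal.ofReal (Real.Gamma (∑ k, ν k) / (∏ k, Real.Gamma (ν k))
          * ∏ k, simplexPoint x k ^ (ν k - 1))
      else 0).map simplexPoint

end PolyaUrn

end

/-!
The mass `(x + y) / S` of the urn grows by one at each step, and `u₂(U(n))`, divided by its growth
`Γ(τ + n + σ) / Γ(τ + n) ∼ n ^ σ`, where `τ` is the initial mass, is a martingale. It is bounded in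
`L²` because `σ > 1 / 2`, so it converges almost surely and in `L²`; this gives the limit `W`
together with its mean and its second moment.

The decomposition is reduced to two parts: `W_{v+w}` has the law of
`B ^ σ W_v + (1 - B) ^ σ W_w`, where `B` is Beta distributed with the masses of `v` and `w` as
parameters. As functions of `(v, w)`, the characteristic functions of both sides are invariant under
averaging over the next draw from the urn `v + w`, the drawn ball being assigned to the part to
which it belongs. Both laws have the same mean, and a variance which tends to `0` as the mass
grows. Hence the difference of the two characteristic functions is at most its supremum over the
pairs that are reached after `n` draws, which tends to `0`, so that it vanishes.

Peeling off one part at a time turns these Beta variables into the stick-breaking construction of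
the Dirichlet distribution.
-/

namespace PolyaUrn

section GammaQuotient

/-- The rising product `∏_{k < n} (1 + s / (τ + k))`, by which the mean of an observable grows in
`n` steps when a single step from total mass `τ + k` multiplies it by `1 + s / (τ + k)`. -/
noncomputable def growth (s τ : ℝ) (n : ℕ) : ℝ := ∏ k ∈ Finset.range n, (1 + s / (τ + k))

/-- The quotient `Γ(τ) / Γ(τ + s)`. It is the limit of `n ^ (-s) * growth s τ n`, and moments of
Beta laws are expressed through it. -/
noncomputable def gammaQuotient (s τ : ℝ) : ℝ := Real.Gamma τ / Real.Gamma (τ + s)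

variable {s τ : ℝ}

theorem growth_zero (s τ : ℝ) : growth s τ 0 = 1 := Finset.prod_range_zero _

theorem growth_succ (s τ : ℝ) (n : ℕ) :
    growth s τ (n + 1) = growth s τ n * (1 + s / (τ + n)) := Finset.prod_range_succ _ _

theorem growth_eq_prod_div_prod (hτ : 0 < τ) (n : ℕ) :
    growth s τ n =
      (∏ k ∈ Finset.range n, (τ + s + k)) / ∏ k ∈ Finset.range n, (τ + k) := by
  rw [growth, ← Finset.prod_div_distrib]
  refine Finset.prod_congr rfl fun k _ => ?_
  field_simp
  ring

theorem growth_pos (hτ : 0 < τ) (hs : 0 < τ + s) (n : ℕ) : 0 < growth s τ n := by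
  rw [growth_eq_prod_div_prod hτ]
  exact div_pos (Finset.prod_pos fun k _ => by positivity)
    (Finset.prod_pos fun k _ => by positivity)

theorem growth_two_mul_le (hτ : 0 < τ) (hs : 0 ≤ s) (n : ℕ) :
    growth (2 * s) τ n ≤ growth s τ n ^ 2 := by
  rw [growth, growth, ← Finset.prod_pow]
  refine Finset.prod_le_prod (fun k _ => by positivity) fun k _ => ?_
  rw [mul_div_assoc]
  linarith [sq_nonneg (s / (τ + k))]

theorem gammaQuotient_zero (hτ : 0 < τ) : gammaQuotient 0 τ = 1 := by
  rw [gammaQuotient, add_zero, div_self (Real.Gamma_pos_of_pos hτ).ne']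

theorem gammaQuotient_pos (hτ : 0 < τ) (hs : 0 < τ + s) : 0 < gammaQuotient s τ :=
  div_pos (Real.Gamma_pos_of_pos hτ) (Real.Gamma_pos_of_pos hs)

theorem growth_div_rpow_eq_gammaSeq (hτ : 0 < τ) (hs : 0 < τ + s) {n : ℕ} (hn : 0 < n) :
    growth s τ n / (n : ℝ) ^ s =
      Real.GammaSeq τ n / Real.GammaSeq (τ + s) n * ((τ + n) / (τ + s + n)) := by
  have hn' : (0 : ℝ) < n := by exact_mod_cast hn
  have : 0 < ∏ k ∈ Finset.range n, (τ + s + (k : ℝ)) := Finset.prod_pos fun k _ => by positivity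
  have : 0 < ∏ k ∈ Finset.range n, (τ + (k : ℝ)) := Finset.prod_pos fun k _ => by positivity
  rw [growth_eq_prod_div_prod hτ, Real.GammaSeq, Real.GammaSeq, Real.rpow_add hn',
    Finset.prod_range_succ, Finset.prod_range_succ]
  field_simp

theorem tendsto_add_natCast_div_add_natCast (x y : ℝ) :
    Tendsto (fun n : ℕ => (x + n) / (y + n)) atTop (𝓝 1) := by
  have hy : Tendsto (fun n : ℕ => y + (n : ℝ)) atTop atTop :=
    tendsto_atTop_add_const_left _ _ tendsto_natCast_atTop_atTop
  have h : Tendsto (fun n : ℕ => 1 + (x - y) / (y + n)) atTop (𝓝 (1 + 0)) :=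
    tendsto_const_nhds.add (tendsto_const_nhds.div_atTop hy)
  rw [add_zero] at h
  refine h.congr' ?_
  filter_upwards [hy.eventually_gt_atTop 0] with n hn
  field_simp
  ring

theorem tendsto_growth_div_rpow (hτ : 0 < τ) (hs : 0 < τ + s) :
    Tendsto (fun n : ℕ => growth s τ n / (n : ℝ) ^ s) atTop (𝓝 (gammaQuotient s τ)) := by
  have h := ((Real.GammaSeq_tendsto_Gamma τ).div (Real.GammaSeq_tendsto_Gamma (τ + s))
    (Real.Gamma_pos_of_pos hs).ne').mul (tendsto_add_natCast_div_add_natCast τ (τ + s))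
  rw [mul_one] at h
  refine h.congr' ?_
  filter_upwards [eventually_gt_atTop 0] with n hn
  exact (growth_div_rpow_eq_gammaSeq hτ hs hn).symm

theorem gammaQuotient_two_mul_le (hτ : 0 < τ) (hs : 0 ≤ s) :
    gammaQuotient (2 * s) τ ≤ gammaQuotient s τ ^ 2 := by
  refine le_of_tendsto_of_tendsto' (tendsto_growth_div_rpow hτ (by positivity))
    ((tendsto_growth_div_rpow hτ (by positivity)).pow 2) fun n => ?_
  rw [div_pow, mul_comm 2 s, Real.rpow_mul (by positivity), mul_comm s 2, Real.rpow_two]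
  gcongr
  exact growth_two_mul_le hτ hs n

theorem gammaQuotient_add_one (hτ : 0 < τ) (hs : 0 < τ + s) :
    gammaQuotient s (τ + 1) * (1 + s / τ) = gammaQuotient s τ := by
  have := Real.Gamma_pos_of_pos hτ
  have := Real.Gamma_pos_of_pos hs
  rw [gammaQuotient, gammaQuotient, add_right_comm, Real.Gamma_add_one hτ.ne',
    Real.Gamma_add_one hs.ne']
  field_simp

theorem gammaQuotient_add_nat_mul_growth (hτ : 0 < τ) (hs : 0 < τ + s) (n : ℕ) :
    gammaQuotient s (τ + n) * growth s τ n = gammaQuotient s τ := by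
  induction n with
  | zero => simp [growth_zero]
  | succ n ih =>
    rw [← ih, growth_succ, ← gammaQuotient_add_one (τ := τ + n) (by positivity)
      (by linarith [n.cast_nonneg (α := ℝ)]), Nat.cast_succ, add_assoc]
    ring

theorem tendsto_mul_gammaQuotient (hτ : 0 < τ) (hs : 1 < s) :
    Tendsto (fun n : ℕ => (τ + n) * gammaQuotient s (τ + n)) atTop (𝓝 0) := by
  have hτs : 0 < τ + s := by linarith
  have hdecay : Tendsto (fun n : ℕ => τ * (n : ℝ) ^ (-s) + (n : ℝ) ^ (-(s - 1))) atTop (𝓝 0) := by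
    simpa using
      (((tendsto_rpow_neg_atTop (by linarith)).comp tendsto_natCast_atTop_atTop).const_mul τ).add
        ((tendsto_rpow_neg_atTop (sub_pos.2 hs)).comp tendsto_natCast_atTop_atTop)
  have hinv := ((tendsto_growth_div_rpow hτ hτs).inv₀ (gammaQuotient_pos hτ hτs).ne').const_mul
    (gammaQuotient s τ)
  have h := hdecay.mul hinv
  rw [zero_mul] at h
  refine h.congr' ?_
  filter_upwards [eventually_gt_atTop 0] with n hn
  have hn' : (0 : ℝ) < n := by exact_mod_cast hn
  have := growth_pos hτ hτs n
  rw [← gammaQuotient_add_nat_mul_growth hτ hτs n, show -(s - 1) = -s + 1 by ring,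
    Real.rpow_add hn', Real.rpow_neg hn'.le, Real.rpow_one]
  field_simp

end GammaQuotient

section Beta

variable {p q : ℝ}

theorem betaPDFReal_nonneg (hp : 0 < p) (hq : 0 < q) (x : ℝ) : 0 ≤ betaPDFReal p q x := by
  by_cases h : 0 < x ∧ x < 1
  · exact (betaPDFReal_pos h.1 h.2 hp hq).le
  · rw [betaPDFReal, if_neg h]

theorem betaPDFReal_mul_rpow {s u : ℝ} (hp : 0 < p) (hq : 0 < q) (hs : 0 < p + s)
    (hu : 0 < q + u) (x : ℝ) :
    betaPDFReal p q x * (x ^ s * (1 - x) ^ u)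
      = beta (p + s) (q + u) / beta p q * betaPDFReal (p + s) (q + u) x := by
  by_cases h : 0 < x ∧ x < 1
  · have := beta_pos hp hq
    have := beta_pos hs hu
    rw [betaPDFReal, betaPDFReal, if_pos h, if_pos h, add_sub_right_comm, add_sub_right_comm q,
      Real.rpow_add h.1, Real.rpow_add (sub_pos.2 h.2)]
    field_simp
  · rw [betaPDFReal, betaPDFReal, if_neg h, if_neg h, zero_mul, mul_zero]

theorem beta_div_beta {s u : ℝ} (hp : 0 < p) (hq : 0 < q) (hs : 0 < p + s) (hu : 0 < q + u) :
    beta (p + s) (q + u) / beta p q =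
      gammaQuotient (s + u) (p + q) / (gammaQuotient s p * gammaQuotient u q) := by
  have := Real.Gamma_pos_of_pos hp
  have := Real.Gamma_pos_of_pos hq
  have := Real.Gamma_pos_of_pos (add_pos hp hq)
  have := Real.Gamma_pos_of_pos hs
  have := Real.Gamma_pos_of_pos hu
  rw [beta, beta, gammaQuotient, gammaQuotient, gammaQuotient, add_add_add_comm]
  field_simp

theorem beta_add_one_left_div_beta (hp : 0 < p) (hq : 0 < q) :
    beta (p + 1) q / beta p q = p / (p + q) := by
  have := Real.Gamma_pos_of_pos hp
  have := Real.Gamma_pos_of_pos hq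
  have := Real.Gamma_pos_of_pos (add_pos hp hq)
  rw [beta, beta, add_right_comm, Real.Gamma_add_one hp.ne', Real.Gamma_add_one (by positivity)]
  field_simp

theorem beta_add_one_right_div_beta (hp : 0 < p) (hq : 0 < q) :
    beta p (q + 1) / beta p q = q / (p + q) := by
  have := Real.Gamma_pos_of_pos hp
  have := Real.Gamma_pos_of_pos hq
  have := Real.Gamma_pos_of_pos (add_pos hp hq)
  rw [beta, beta, ← add_assoc, Real.Gamma_add_one hq.ne', Real.Gamma_add_one (by positivity)]
  field_simp

theorem betaPDFReal_eq_add (hp : 0 < p) (hq : 0 < q) (x : ℝ) :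
    betaPDFReal p q x = p / (p + q) * betaPDFReal (p + 1) q x
      + q / (p + q) * betaPDFReal p (q + 1) x := by
  have hleft := betaPDFReal_mul_rpow (s := 1) (u := 0) hp hq (by positivity) (by simpa) x
  have hright := betaPDFReal_mul_rpow (s := 0) (u := 1) hp hq (by simpa) (by positivity) x
  simp only [Real.rpow_one, Real.rpow_zero, mul_one, one_mul, add_zero] at hleft hright
  rw [← beta_add_one_left_div_beta hp hq, ← beta_add_one_right_div_beta hp hq, ← hleft, ← hright]
  ring

theorem measurable_betaPDF (p q : ℝ) : Measurable (betaPDF p q) :=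
  (measurable_betaPDFReal p q).ennreal_ofReal

theorem ae_betaMeasure_mem_Ioo (p q : ℝ) : ∀ᵐ x ∂(betaMeasure p q), x ∈ Set.Ioo (0 : ℝ) 1 := by
  rw [betaMeasure, ae_withDensity_iff (measurable_betaPDF p q)]
  refine .of_forall fun x hx => ?_
  contrapose! hx
  rw [betaPDF_eq, if_neg (mt Set.mem_Ioo.2 hx), ENNReal.ofReal_zero]

variable {E : Type*} [NormedAddCommGroup E] [NormedSpace ℝ E]

theorem integral_betaMeasure (hp : 0 < p) (hq : 0 < q) (f : ℝ → E) :
    ∫ x, f x ∂(betaMeasure p q) = ∫ x, betaPDFReal p q x • f x := by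
  rw [betaMeasure, integral_withDensity_eq_integral_toReal_smul (measurable_betaPDF p q)
    (.of_forall fun _ => ENNReal.ofReal_lt_top)]
  simp only [betaPDF, ENNReal.toReal_ofReal (betaPDFReal_nonneg hp hq _)]

theorem integrable_betaMeasure_iff (hp : 0 < p) (hq : 0 < q) {f : ℝ → E} :
    Integrable f (betaMeasure p q) ↔ Integrable (fun x => betaPDFReal p q x • f x) := by
  rw [betaMeasure, integrable_withDensity_iff_integrable_smul' (measurable_betaPDF p q)
    (.of_forall fun _ => ENNReal.ofReal_lt_top)]
  simp only [betaPDF, ENNReal.toReal_ofReal (betaPDFReal_nonneg hp hq _)]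

theorem integrable_betaPDFReal (hp : 0 < p) (hq : 0 < q) : Integrable (betaPDFReal p q) := by
  have := isProbabilityMeasureBeta hp hq
  simpa using (integrable_betaMeasure_iff hp hq (f := fun _ => (1 : ℝ))).1 (integrable_const _)

theorem integral_betaPDFReal (hp : 0 < p) (hq : 0 < q) : ∫ x, betaPDFReal p q x = 1 := by
  have := isProbabilityMeasureBeta hp hq
  simpa using (integral_betaMeasure hp hq (fun _ => (1 : ℝ))).symm

theorem integrable_rpow_mul_rpow_betaMeasure {s u : ℝ} (hp : 0 < p) (hq : 0 < q)
    (hs : 0 < p + s) (hu : 0 < q + u) :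
    Integrable (fun x => x ^ s * (1 - x) ^ u) (betaMeasure p q) := by
  simp only [integrable_betaMeasure_iff hp hq, smul_eq_mul, betaPDFReal_mul_rpow hp hq hs hu]
  exact (integrable_betaPDFReal hs hu).const_mul _

theorem integral_rpow_mul_rpow_betaMeasure {s u : ℝ} (hp : 0 < p) (hq : 0 < q)
    (hs : 0 < p + s) (hu : 0 < q + u) :
    ∫ x, x ^ s * (1 - x) ^ u ∂(betaMeasure p q) =
      gammaQuotient (s + u) (p + q) / (gammaQuotient s p * gammaQuotient u q) := by
  simp only [integral_betaMeasure hp hq, smul_eq_mul, betaPDFReal_mul_rpow hp hq hs hu]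
  rw [integral_const_mul, integral_betaPDFReal hs hu, mul_one, beta_div_beta hp hq hs hu]

theorem integral_rpow_betaMeasure {s : ℝ} (hp : 0 < p) (hq : 0 < q) (hs : 0 < p + s) :
    ∫ x, x ^ s ∂(betaMeasure p q) = gammaQuotient s (p + q) / gammaQuotient s p := by
  simpa [gammaQuotient_zero hq] using
    integral_rpow_mul_rpow_betaMeasure (u := 0) hp hq hs (by rwa [add_zero])

theorem integral_one_sub_rpow_betaMeasure {s : ℝ} (hp : 0 < p) (hq : 0 < q) (hs : 0 < q + s) :
    ∫ x, (1 - x) ^ s ∂(betaMeasure p q) = gammaQuotient s (p + q) / gammaQuotient s q := by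
  simpa [gammaQuotient_zero hp] using
    integral_rpow_mul_rpow_betaMeasure (s := 0) hp hq (by rwa [add_zero]) hs

theorem ae_rpow_sq_betaMeasure (p q s : ℝ) :
    ∀ᵐ x ∂(betaMeasure p q), (x ^ s) ^ 2 = x ^ (2 * s) := by
  filter_upwards [ae_betaMeasure_mem_Ioo p q] with x hx
  rw [mul_comm 2 s, Real.rpow_mul hx.1.le, Real.rpow_two]

theorem ae_one_sub_rpow_sq_betaMeasure (p q s : ℝ) :
    ∀ᵐ x ∂(betaMeasure p q), ((1 - x) ^ s) ^ 2 = (1 - x) ^ (2 * s) := by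
  filter_upwards [ae_betaMeasure_mem_Ioo p q] with x hx
  rw [mul_comm 2 s, Real.rpow_mul (sub_nonneg.2 hx.2.le), Real.rpow_two]

theorem memLp_two_rpow_betaMeasure {s : ℝ} (hp : 0 < p) (hq : 0 < q) (hs : 0 < p + 2 * s) :
    MemLp (fun x => x ^ s) 2 (betaMeasure p q) := by
  rw [memLp_two_iff_integrable_sq (by fun_prop),
    integrable_congr (ae_rpow_sq_betaMeasure p q s)]
  simpa using integrable_rpow_mul_rpow_betaMeasure (u := 0) hp hq hs (by rwa [add_zero])

theorem memLp_two_one_sub_rpow_betaMeasure {s : ℝ} (hp : 0 < p) (hq : 0 < q)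
    (hs : 0 < q + 2 * s) : MemLp (fun x => (1 - x) ^ s) 2 (betaMeasure p q) := by
  rw [memLp_two_iff_integrable_sq (Measurable.aestronglyMeasurable (by fun_prop)),
    integrable_congr (ae_one_sub_rpow_sq_betaMeasure p q s)]
  simpa using integrable_rpow_mul_rpow_betaMeasure (s := 0) hp hq (by rwa [add_zero]) hs

theorem integral_betaMeasure_eq_add (hp : 0 < p) (hq : 0 < q) {f : ℝ → E}
    (hleft : Integrable f (betaMeasure (p + 1) q))
    (hright : Integrable f (betaMeasure p (q + 1))) :
    ∫ x, f x ∂(betaMeasure p q) = (p / (p + q)) • ∫ x, f x ∂(betaMeasure (p + 1) q)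
      + (q / (p + q)) • ∫ x, f x ∂(betaMeasure p (q + 1)) := by
  rw [integrable_betaMeasure_iff (by positivity) (by positivity)] at hleft hright
  rw [integral_betaMeasure hp hq, integral_betaMeasure (by positivity) hq,
    integral_betaMeasure hp (by positivity), ← integral_smul, ← integral_smul,
    ← integral_add (by exact hleft.smul (p / (p + q))) (by exact hright.smul (q / (p + q)))]
  simp only [betaPDFReal_eq_add hp hq, add_smul, mul_smul]

end Beta

section Moments

/-- The law `μ` has mean `r` and second moment at most `q`. -/
structure HasMoments (μ : Measure ℝ) (r q : ℝ) : Prop where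
  memLp : MemLp (fun x => x) 2 μ
  mean : ∫ x, x ∂μ = r
  integral_sq_le : ∫ x, x ^ 2 ∂μ ≤ q

variable {Ω : Type*} [MeasurableSpace Ω] {P : Measure Ω} {r q : ℝ}

theorem hasMoments_map_iff {X : Ω → ℝ} (hX : AEMeasurable X P) :
    HasMoments (P.map X) r q ↔
      MemLp X 2 P ∧ ∫ ω, X ω ∂P = r ∧ ∫ ω, X ω ^ 2 ∂P ≤ q := by
  have hmem : MemLp (fun x => x) 2 (P.map X) ↔ MemLp X 2 P :=
    memLp_map_measure_iff aestronglyMeasurable_id hX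
  have hmean : ∫ x, x ∂(P.map X) = ∫ ω, X ω ∂P := integral_map hX aestronglyMeasurable_id
  have hsq : ∫ x, x ^ 2 ∂(P.map X) = ∫ ω, X ω ^ 2 ∂P :=
    integral_map hX (by fun_prop : Measurable fun x : ℝ => x ^ 2).aestronglyMeasurable
  rw [← hmem, ← hmean, ← hsq]
  exact ⟨fun h => ⟨h.1, h.2, h.3⟩, fun h => ⟨h.1, h.2.1, h.2.2⟩⟩

theorem integral_sub_const_sq [IsProbabilityMeasure P] {X : Ω → ℝ} (hX : MemLp X 2 P) (e : ℝ) :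
    ∫ ω, (X ω - e) ^ 2 ∂P = ∫ ω, X ω ^ 2 ∂P - 2 * e * ∫ ω, X ω ∂P + e ^ 2 := by
  have hX1 := (hX.integrable one_le_two).const_mul (2 * e)
  calc ∫ ω, (X ω - e) ^ 2 ∂P = ∫ ω, (X ω ^ 2 - 2 * e * X ω + e ^ 2) ∂P := by
        congr with ω
        ring
    _ = _ := by
        rw [integral_add (by exact hX.integrable_sq.sub hX1) (integrable_const _),
          integral_sub hX.integrable_sq hX1, integral_const_mul, integral_const, probReal_univ,
          one_smul]

-- Letting `e` be arbitrary turns the equation for the mean into inequalities, which Fatou's lemma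
-- transfers to limits.
theorem hasMoments_map_iff_forall_integral_sub_sq_le [IsProbabilityMeasure P] {X : Ω → ℝ}
    (hX : AEMeasurable X P) :
    HasMoments (P.map X) r q ↔
      ∀ e : ℝ, MemLp (fun ω => X ω - e) 2 P ∧
        ∫ ω, (X ω - e) ^ 2 ∂P ≤ q - 2 * e * r + e ^ 2 := by
  rw [hasMoments_map_iff hX]
  constructor
  · rintro ⟨hmem, rfl, hsq⟩ e
    rw [integral_sub_const_sq hmem]
    exact ⟨hmem.sub (memLp_const e), by linarith⟩
  · intro h
    have hmem : MemLp X 2 P := by simpa using (h 0).1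
    have hle (e : ℝ) : ∫ ω, X ω ^ 2 ∂P - q ≤ 2 * e * (∫ ω, X ω ∂P - r) := by
      have := (h e).2
      rw [integral_sub_const_sq hmem] at this
      linarith
    refine ⟨hmem, ?_, by simpa using hle 0⟩
    by_contra hne
    have hne' : ∫ ω, X ω ∂P - r ≠ 0 := sub_ne_zero.2 hne
    have := hle ((∫ ω, X ω ^ 2 ∂P - q - 1) / (2 * (∫ ω, X ω ∂P - r)))
    field_simp at this
    linarith

theorem integral_le_of_tendsto_ae {f : ℕ → Ω → ℝ} {g : Ω → ℝ} {L : ℕ → ℝ} {l : ℝ}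
    (hf : ∀ n, Integrable (f n) P) (hf0 : ∀ n ω, 0 ≤ f n ω)
    (hfg : ∀ᵐ ω ∂P, Tendsto (fun n => f n ω) atTop (𝓝 (g ω)))
    (hfL : ∀ n, ∫ ω, f n ω ∂P ≤ L n) (hL : Tendsto L atTop (𝓝 l)) :
    Integrable g P ∧ ∫ ω, g ω ∂P ≤ l := by
  have hg0 : ∀ᵐ ω ∂P, 0 ≤ g ω := by
    filter_upwards [hfg] with ω hω using ge_of_tendsto' hω fun n => hf0 n ω
  have hl0 : 0 ≤ l := ge_of_tendsto' hL fun n => (integral_nonneg (hf0 n)).trans (hfL n)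
  have fatou : ∫⁻ ω, ENNReal.ofReal (g ω) ∂P ≤ ENNReal.ofReal l := by
    calc ∫⁻ ω, ENNReal.ofReal (g ω) ∂P
        = ∫⁻ ω, liminf (fun n => ENNReal.ofReal (f n ω)) atTop ∂P := by
          refine lintegral_congr_ae ?_
          filter_upwards [hfg] with ω hω using (ENNReal.tendsto_ofReal hω).liminf_eq.symm
      _ ≤ liminf (fun n => ∫⁻ ω, ENNReal.ofReal (f n ω) ∂P) atTop :=
          lintegral_liminf_le' fun n => (hf n).aemeasurable.ennreal_ofReal
      _ ≤ liminf (fun n => ENNReal.ofReal (L n)) atTop := by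
          refine liminf_le_liminf (.of_forall fun n => ?_)
          rw [← ofReal_integral_eq_lintegral_ofReal (hf n) (.of_forall (hf0 n))]
          exact ENNReal.ofReal_le_ofReal (hfL n)
      _ = ENNReal.ofReal l := (ENNReal.tendsto_ofReal hL).liminf_eq
  have hg : Integrable g P := by
    refine ⟨aestronglyMeasurable_of_tendsto_ae atTop (fun n => (hf n).1) hfg, ?_⟩
    rw [hasFiniteIntegral_iff_ofReal hg0]
    exact fatou.trans_lt ENNReal.ofReal_lt_top
  rw [← ofReal_integral_eq_lintegral_ofReal hg hg0, ENNReal.ofReal_le_ofReal_iff hl0] at fatou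
  exact ⟨hg, fatou⟩

theorem HasMoments.of_tendsto_ae [IsProbabilityMeasure P] {X : ℕ → Ω → ℝ} {Y : Ω → ℝ}
    {rs qs : ℕ → ℝ} (hX : ∀ n, AEMeasurable (X n) P)
    (hm : ∀ n, HasMoments (P.map (X n)) (rs n) (qs n))
    (hXY : ∀ᵐ ω ∂P, Tendsto (fun n => X n ω) atTop (𝓝 (Y ω)))
    (hr : Tendsto rs atTop (𝓝 r)) (hq : Tendsto qs atTop (𝓝 q)) :
    HasMoments (P.map Y) r q := by
  have hY : AEMeasurable Y P := aemeasurable_of_tendsto_metrizable_ae atTop hX hXY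
  rw [hasMoments_map_iff_forall_integral_sub_sq_le hY]
  intro e
  rw [memLp_two_iff_integrable_sq (hY.sub_const e).aestronglyMeasurable]
  have he (n : ℕ) := (hasMoments_map_iff_forall_integral_sub_sq_le (hX n)).1 (hm n) e
  refine integral_le_of_tendsto_ae (fun n => (he n).1.integrable_sq) (fun n ω => sq_nonneg _) ?_
    (fun n => (he n).2) ((hq.sub (hr.const_mul (2 * e))).add_const (e ^ 2))
  filter_upwards [hXY] with ω hω using (hω.sub_const e).pow 2

theorem integral_abs_le_sqrt [IsProbabilityMeasure P] {X : Ω → ℝ} (hX : MemLp X 2 P) :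
    ∫ ω, |X ω| ∂P ≤ √(∫ ω, X ω ^ 2 ∂P) := by
  have h := variance_nonneg (fun ω => |X ω|) P
  rw [variance_eq_sub (by exact hX.abs)] at h
  simp only [Pi.pow_apply, sq_abs, sub_nonneg] at h
  exact Real.le_sqrt_of_sq_le h

theorem norm_exp_mul_I_sub_exp_mul_I_le (x y : ℝ) :
    ‖Complex.exp (x * Complex.I) - Complex.exp (y * Complex.I)‖ ≤ |x - y| := by
  have h : Complex.exp (x * Complex.I) - Complex.exp (y * Complex.I)
      = Complex.exp (y * Complex.I) * (Complex.exp (Complex.I * (x - y : ℝ)) - 1) := by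
    rw [mul_sub, mul_one, ← Complex.exp_add]
    push_cast
    ring_nf
  rw [h, norm_mul, Complex.norm_exp_ofReal_mul_I, one_mul]
  exact Real.norm_exp_I_mul_ofReal_sub_one_le

theorem HasMoments.norm_charFun_sub_le {μ : Measure ℝ} [IsProbabilityMeasure μ]
    (h : HasMoments μ r q) (t : ℝ) :
    ‖charFun μ t - Complex.exp (t * r * Complex.I)‖ ≤ |t| * √(q - r ^ 2) := by
  have hdev : MemLp (fun x : ℝ => x - r) 2 μ := h.memLp.sub (memLp_const r)
  have hvar : ∫ x, (x - r) ^ 2 ∂μ ≤ q - r ^ 2 := by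
    have := integral_sub_const_sq h.memLp r
    simp only [h.mean] at this
    linarith [h.integral_sq_le]
  have hexp : Integrable (fun x : ℝ => Complex.exp (t * x * Complex.I)) μ := by
    refine .of_bound (by fun_prop) 1 (.of_forall fun x => ?_)
    rw [← Complex.ofReal_mul, Complex.norm_exp_ofReal_mul_I]
  calc ‖charFun μ t - Complex.exp (t * r * Complex.I)‖
      = ‖∫ x : ℝ, (Complex.exp (t * x * Complex.I) - Complex.exp (t * r * Complex.I)) ∂μ‖ := by
        rw [integral_sub hexp (integrable_const _), charFun_apply_real, integral_const,
          probReal_univ, one_smul]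
    _ ≤ ∫ x, |t| * |x - r| ∂μ := by
        refine norm_integral_le_of_norm_le ((hdev.abs.integrable one_le_two).const_mul _)
          (.of_forall fun x => ?_)
        simpa [← mul_sub, abs_mul] using norm_exp_mul_I_sub_exp_mul_I_le (t * x) (t * r)
    _ = |t| * ∫ x, |x - r| ∂μ := integral_const_mul _ _
    _ ≤ |t| * √(q - r ^ 2) := by
        gcongr
        exact (integral_abs_le_sqrt hdev).trans (Real.sqrt_le_sqrt hvar)

theorem HasMoments.norm_charFun_sub_charFun_le {μ ν : Measure ℝ} [IsProbabilityMeasure μ]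
    [IsProbabilityMeasure ν] (hμ : HasMoments μ r q) (hν : HasMoments ν r q) (t : ℝ) :
    ‖charFun μ t - charFun ν t‖ ≤ 2 * (|t| * √(q - r ^ 2)) := by
  have h := norm_sub_le_norm_sub_add_norm_sub (charFun μ t) (Complex.exp (t * r * Complex.I))
    (charFun ν t)
  rw [norm_sub_rev (Complex.exp _) (charFun ν t)] at h
  linarith [hμ.norm_charFun_sub_le t, hν.norm_charFun_sub_le t]

end Moments

section RandomCombination

variable {Ω : Type*} [MeasurableSpace Ω] {ρ : Measure Ω} {f g : Ω → ℝ} {μ ν : Measure ℝ}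

/-- The law of `f(T) X + g(T) Y`, where `T`, `X` and `Y` are independent with laws `ρ`, `μ` and
`ν`. -/
noncomputable def randomCombination (ρ : Measure Ω) (f g : Ω → ℝ) (μ ν : Measure ℝ) :
    Measure ℝ :=
  (ρ.prod (μ.prod ν)).map fun z => f z.1 * z.2.1 + g z.1 * z.2.2

theorem aemeasurable_combination (hf : AEMeasurable f ρ) (hg : AEMeasurable g ρ) :
    AEMeasurable (fun z : Ω × ℝ × ℝ => f z.1 * z.2.1 + g z.1 * z.2.2) (ρ.prod (μ.prod ν)) :=
  (hf.comp_fst.mul (by fun_prop)).add (hg.comp_fst.mul (by fun_prop))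

variable [IsProbabilityMeasure μ] [IsProbabilityMeasure ν]

theorem isProbabilityMeasure_randomCombination [IsProbabilityMeasure ρ] (hf : AEMeasurable f ρ)
    (hg : AEMeasurable g ρ) : IsProbabilityMeasure (randomCombination ρ f g μ ν) :=
  Measure.isProbabilityMeasure_map (aemeasurable_combination hf hg)

theorem charFun_randomCombination [IsFiniteMeasure ρ] (hf : AEMeasurable f ρ)
    (hg : AEMeasurable g ρ) (t : ℝ) :
    charFun (randomCombination ρ f g μ ν) t =
      ∫ ω, charFun μ (t * f ω) * charFun ν (t * g ω) ∂ρ := by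
  have hX := aemeasurable_combination (μ := μ) (ν := ν) hf hg
  have hint : Integrable (fun z : Ω × ℝ × ℝ =>
      Complex.exp (t * ↑(f z.1 * z.2.1 + g z.1 * z.2.2) * Complex.I)) (ρ.prod (μ.prod ν)) := by
    refine .of_bound (by fun_prop) 1 (.of_forall fun z => ?_)
    rw [← Complex.ofReal_mul, Complex.norm_exp_ofReal_mul_I]
  rw [charFun_apply_real, randomCombination, integral_map hX (by fun_prop), integral_prod _ hint]
  congr with ω
  rw [charFun_apply_real, charFun_apply_real, ← integral_prod_mul]
  congr with z
  rw [← Complex.exp_add]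
  push_cast
  ring_nf

theorem memLp_combination (hf : MemLp f 2 ρ) (hg : MemLp g 2 ρ)
    (hμ : MemLp (fun x => x) 2 μ) (hν : MemLp (fun x => x) 2 ν) :
    MemLp (fun z : Ω × ℝ × ℝ => f z.1 * z.2.1 + g z.1 * z.2.2) 2 (ρ.prod (μ.prod ν)) := by
  have hf' := hf.1.comp_fst (ν := μ.prod ν)
  have hg' := hg.1.comp_fst (ν := μ.prod ν)
  refine .add ((memLp_two_iff_integrable_sq (hf'.mul (by fun_prop))).2 ?_)
    ((memLp_two_iff_integrable_sq (hg'.mul (by fun_prop))).2 ?_)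
  · simpa only [Pi.mul_apply, mul_pow] using
      hf.integrable_sq.mul_prod (hμ.integrable_sq.comp_fst ν)
  · simpa only [Pi.mul_apply, mul_pow] using
      hg.integrable_sq.mul_prod (hν.integrable_sq.comp_snd μ)

variable [IsFiniteMeasure ρ]

theorem integral_combination (hf : Integrable f ρ) (hg : Integrable g ρ)
    (hμ : Integrable (fun x => x) μ) (hν : Integrable (fun x => x) ν) :
    ∫ z, (f z.1 * z.2.1 + g z.1 * z.2.2) ∂(ρ.prod (μ.prod ν)) =
      (∫ ω, f ω ∂ρ) * (∫ x, x ∂μ) + (∫ ω, g ω ∂ρ) * (∫ x, x ∂ν) := by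
  rw [integral_add (hf.mul_prod (hμ.comp_fst ν)) (hg.mul_prod (hν.comp_snd μ)),
    integral_prod_mul f, integral_prod_mul g, integral_fun_fst (fun x : ℝ => x),
    integral_fun_snd (fun x : ℝ => x), probReal_univ, probReal_univ, one_smul, one_smul]

theorem integral_combination_sq (hf : MemLp f 2 ρ) (hg : MemLp g 2 ρ)
    (hμ : MemLp (fun x => x) 2 μ) (hν : MemLp (fun x => x) 2 ν) :
    ∫ z, (f z.1 * z.2.1 + g z.1 * z.2.2) ^ 2 ∂(ρ.prod (μ.prod ν)) =
      (∫ ω, f ω ^ 2 ∂ρ) * (∫ x, x ^ 2 ∂μ) + (∫ ω, g ω ^ 2 ∂ρ) * (∫ x, x ^ 2 ∂ν)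
        + 2 * (∫ ω, f ω * g ω ∂ρ) * ((∫ x, x ∂μ) * ∫ x, x ∂ν) := by
  have hfμ := hf.integrable_sq.mul_prod (hμ.integrable_sq.comp_fst ν)
  have hgν := hg.integrable_sq.mul_prod (hν.integrable_sq.comp_snd μ)
  have hcross : Integrable (fun z : Ω × ℝ × ℝ => 2 * (f z.1 * g z.1 * (z.2.1 * z.2.2)))
      (ρ.prod (μ.prod ν)) :=
    ((hf.integrable_mul hg).mul_prod
      ((hμ.integrable one_le_two).mul_prod (hν.integrable one_le_two))).const_mul 2
  calc ∫ z, (f z.1 * z.2.1 + g z.1 * z.2.2) ^ 2 ∂(ρ.prod (μ.prod ν))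
      = ∫ z, (f z.1 ^ 2 * z.2.1 ^ 2 + g z.1 ^ 2 * z.2.2 ^ 2
          + 2 * (f z.1 * g z.1 * (z.2.1 * z.2.2))) ∂(ρ.prod (μ.prod ν)) := by
        congr with z
        ring
    _ = _ := by
        rw [integral_add (by exact hfμ.add hgν) hcross, integral_add hfμ hgν,
          integral_const_mul, integral_prod_mul (fun ω => f ω ^ 2) (fun z : ℝ × ℝ => z.1 ^ 2),
          integral_prod_mul (fun ω => g ω ^ 2) (fun z : ℝ × ℝ => z.2 ^ 2),
          integral_prod_mul (fun ω => f ω * g ω) (fun z : ℝ × ℝ => z.1 * z.2),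
          integral_prod_mul (fun x : ℝ => x) (fun x : ℝ => x),
          integral_fun_fst (fun x : ℝ => x ^ 2), integral_fun_snd (fun x : ℝ => x ^ 2),
          probReal_univ, probReal_univ, one_smul, one_smul, ← mul_assoc]

theorem HasMoments.randomCombination {r q r' q' : ℝ} (hμ : HasMoments μ r q)
    (hν : HasMoments ν r' q') (hf : MemLp f 2 ρ) (hg : MemLp g 2 ρ) :
    HasMoments (randomCombination ρ f g μ ν) ((∫ ω, f ω ∂ρ) * r + (∫ ω, g ω ∂ρ) * r')
      ((∫ ω, f ω ^ 2 ∂ρ) * q + (∫ ω, g ω ^ 2 ∂ρ) * q'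
        + 2 * (∫ ω, f ω * g ω ∂ρ) * (r * r')) := by
  refine (hasMoments_map_iff (aemeasurable_combination hf.1.aemeasurable hg.1.aemeasurable)).2
    ⟨memLp_combination hf hg hμ.memLp hν.memLp, ?_, ?_⟩
  · rw [integral_combination (hf.integrable one_le_two) (hg.integrable one_le_two)
      (hμ.memLp.integrable one_le_two) (hν.memLp.integrable one_le_two), hμ.mean, hν.mean]
  · rw [integral_combination_sq hf hg hμ.memLp hν.memLp, hμ.mean, hν.mean]
    gcongr
    exacts [hμ.integral_sq_le, hν.integral_sq_le]

end RandomCombination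

section Chain

variable {a b c d : ℕ} {v : ℕ × ℕ}

theorem stepKernel_zero (a b c d : ℕ) : stepKernel a b c d 0 = Measure.dirac 0 :=
  show stepMeasure a b c d (0, 0) = _ from if_pos rfl

theorem stepKernel_of_ne_zero (a b c d : ℕ) (hv : v ≠ 0) :
    stepKernel a b c d v =
      ((v.1 : ℝ≥0∞) / (v.1 + v.2)) • Measure.dirac (v + (a, b))
        + ((v.2 : ℝ≥0∞) / (v.1 + v.2)) • Measure.dirac (v + (c, d)) :=
  if_neg hv

theorem ae_stepKernel_of_forall {p : ℕ × ℕ → Prop} (hv : v ≠ 0) (hred : p (v + (a, b)))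
    (hblack : p (v + (c, d))) : ∀ᵐ w ∂(stepKernel a b c d v), p w := by
  rw [stepKernel_of_ne_zero a b c d hv, ae_add_measure_iff]
  constructor
  all_goals
    refine Measure.ae_smul_measure ?_ _
    rwa [ae_dirac_eq]

theorem ae_stepKernel_mem (a b c d : ℕ) (v : ℕ × ℕ) :
    ∀ᵐ w ∂(stepKernel a b c d v), w ∈ ({v, v + (a, b), v + (c, d)} : Finset (ℕ × ℕ)) := by
  rcases eq_or_ne v 0 with rfl | hv
  · rw [stepKernel_zero, ae_dirac_eq]
    simp
  · exact ae_stepKernel_of_forall hv (by simp) (by simp)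

theorem cast_add_cast_pos (hv : v ≠ 0) : 0 < (v.1 : ℝ) + v.2 := by
  have : v.1 + v.2 ≠ 0 := by simpa [Prod.ext_iff] using hv
  exact_mod_cast Nat.pos_of_ne_zero this

theorem urnLaw_eq_traj (a b c d : ℕ) (v : ℕ × ℕ) :
    urnLaw a b c d v.1 v.2 =
      Kernel.traj (X := fun _ => ℕ × ℕ) (historyKernel a b c d) 0 (fun _ => v) := by
  have h : (Measure.dirac v).map
      (MeasurableEquiv.piUnique (fun i : Finset.Iic 0 => (fun _ : ℕ => ℕ × ℕ) i)).symm =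
        Measure.dirac (fun _ => v) :=
    Measure.map_dirac' (MeasurableEquiv.measurable _) _
  exact (congrArg (Measure.bind · _) h).trans (Measure.dirac_bind (Kernel.measurable _) _)

instance (a b c d α β : ℕ) : IsProbabilityMeasure (urnLaw a b c d α β) := by
  unfold urnLaw
  infer_instance

theorem urnLaw_map_succ (a b c d α β n : ℕ) :
    (urnLaw a b c d α β).map (fun U => U (n + 1)) =
      stepKernel a b c d ∘ₘ (urnLaw a b c d α β).map (fun U => U n) := by
  have h := congrArg Measure.snd <|
    Kernel.map_frestrictLe_trajMeasure_compProd_eq_map_trajMeasure (X := fun _ => ℕ × ℕ)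
      (μ₀ := Measure.dirac (α, β)) (κ := historyKernel a b c d) (a := n)
  rw [Measure.snd_compProd, Measure.snd_map_prodMk (by fun_prop)] at h
  refine h.symm.trans ?_
  ext s hs
  rw [Measure.bind_apply hs (Kernel.aemeasurable _), Measure.bind_apply hs (Kernel.aemeasurable _),
    lintegral_map (Kernel.measurable_coe _ hs) (by fun_prop),
    lintegral_map (Kernel.measurable_coe _ hs) (by fun_prop)]
  rfl

theorem ae_urnLaw_zero (a b c d : ℕ) (v : ℕ × ℕ) :
    ∀ᵐ U ∂(urnLaw a b c d v.1 v.2), U 0 = v := by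
  rw [urnLaw_eq_traj]
  have h := Kernel.traj_map_frestrictLe_apply (X := fun _ => ℕ × ℕ)
    (κ := historyKernel a b c d) 0 0 (fun _ => v)
  rw [Kernel.partialTraj_self, Kernel.id_apply] at h
  have hx : ∀ᵐ x ∂((Kernel.traj (X := fun _ => ℕ × ℕ) (historyKernel a b c d) 0
      (fun _ => v)).map (Preorder.frestrictLe 0)), x = fun _ => v := by
    rw [h, ae_dirac_eq]
    rfl
  filter_upwards [ae_of_ae_map (by fun_prop) hx] with U hU
  exact congrFun hU ⟨0, by simp⟩

theorem ae_urnLaw_succ {p : ℕ × ℕ → Prop} {α β n : ℕ}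
    (h : ∀ᵐ U ∂(urnLaw a b c d α β), ∀ᵐ w ∂(stepKernel a b c d (U n)), p w) :
    ∀ᵐ U ∂(urnLaw a b c d α β), p (U (n + 1)) := by
  have hmeas (k : ℕ) : AEMeasurable (fun U : ℕ → ℕ × ℕ => U k) (urnLaw a b c d α β) :=
    (measurable_pi_apply k).aemeasurable
  refine ae_of_ae_map (hmeas (n + 1)) ?_
  rw [urnLaw_map_succ]
  refine Measure.ae_comp_of_ae_ae .of_discrete ?_
  rwa [ae_map_iff (hmeas n) .of_discrete]

theorem exists_finset_ae_urnLaw_mem (a b c d : ℕ) (v : ℕ × ℕ) (n : ℕ) :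
    ∃ s : Finset (ℕ × ℕ), ∀ᵐ U ∂(urnLaw a b c d v.1 v.2), U n ∈ s := by
  classical
  induction n with
  | zero =>
    refine ⟨{v}, ?_⟩
    filter_upwards [ae_urnLaw_zero a b c d v] with U hU
    rw [hU, Finset.mem_singleton]
  | succ n ih =>
    obtain ⟨s, hs⟩ := ih
    refine ⟨s.biUnion fun u => {u, u + (a, b), u + (c, d)}, ae_urnLaw_succ ?_⟩
    filter_upwards [hs] with U hU
    filter_upwards [ae_stepKernel_mem a b c d (U n)] with w hw
    exact Finset.mem_biUnion.2 ⟨U n, hU, hw⟩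

variable {E : Type*} [NormedAddCommGroup E]

theorem integrable_urnLaw (a b c d : ℕ) (v : ℕ × ℕ) (f : ℕ × ℕ → E) (n : ℕ) :
    Integrable (fun U => f (U n)) (urnLaw a b c d v.1 v.2) := by
  obtain ⟨s, hs⟩ := exists_finset_ae_urnLaw_mem a b c d v n
  refine .of_bound (C := ∑ w ∈ s, ‖f w‖) ?_ ?_
  · exact ((StronglyMeasurable.of_discrete (f := f)).comp_measurable
      (measurable_pi_apply n)).aestronglyMeasurable
  · filter_upwards [hs] with U hU
    exact Finset.single_le_sum (f := fun w => ‖f w‖) (fun _ _ => norm_nonneg _) hU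

theorem memLp_urnLaw (a b c d : ℕ) (v : ℕ × ℕ) (f : ℕ × ℕ → ℝ) (n : ℕ) :
    MemLp (fun U => f (U n)) 2 (urnLaw a b c d v.1 v.2) := by
  rw [memLp_two_iff_integrable_sq (integrable_urnLaw a b c d v f n).1]
  exact integrable_urnLaw a b c d v (fun w => f w ^ 2) n

theorem integrable_stepKernel (a b c d : ℕ) (v : ℕ × ℕ) (f : ℕ × ℕ → E) :
    Integrable f (stepKernel a b c d v) := by
  refine .of_bound (C := ∑ w ∈ {v, v + (a, b), v + (c, d)}, ‖f w‖) .of_discrete ?_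
  filter_upwards [ae_stepKernel_mem a b c d v] with w hw
  exact Finset.single_le_sum (f := fun w => ‖f w‖) (fun _ _ => norm_nonneg _) hw

variable [NormedSpace ℝ E] [CompleteSpace E]

theorem integral_stepKernel (a b c d : ℕ) (f : ℕ × ℕ → E) (hv : v ≠ 0) :
    ∫ w, f w ∂(stepKernel a b c d v) =
      ((v.1 : ℝ) / (v.1 + v.2)) • f (v + (a, b))
        + ((v.2 : ℝ) / (v.1 + v.2)) • f (v + (c, d)) := by
  have hfin (k : ℕ) : (k : ℝ≥0∞) / (v.1 + v.2) ≠ ∞ :=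
    ENNReal.div_ne_top (by simp) (by exact_mod_cast (cast_add_cast_pos hv).ne')
  rw [stepKernel_of_ne_zero a b c d hv,
    integral_add_measure ((integrable_dirac (by simp)).smul_measure (hfin _))
      ((integrable_dirac (by simp)).smul_measure (hfin _)),
    integral_smul_measure, integral_smul_measure, integral_dirac, integral_dirac]
  simp [ENNReal.toReal_div, ENNReal.toReal_add]

theorem condExp_urnLaw (a b c d : ℕ) (v : ℕ × ℕ) (f : ℕ × ℕ → E) (n : ℕ) :
    (urnLaw a b c d v.1 v.2)[fun U => f (U (n + 1)) | Filtration.piLE (X := fun _ => ℕ × ℕ) n]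
      =ᵐ[urnLaw a b c d v.1 v.2] fun U => ∫ w, f w ∂(stepKernel a b c d (U n)) := by
  have hint := integrable_urnLaw a b c d v f (n + 1)
  rw [urnLaw_eq_traj] at hint ⊢
  filter_upwards [Kernel.condExp_traj (Nat.zero_le n) hint] with U hU
  have hmap := congrArg (fun κ => κ (Preorder.frestrictLe n U)) <|
    Kernel.map_traj_succ_self (X := fun _ => ℕ × ℕ) (κ := historyKernel a b c d) (a := n)
  rw [Kernel.map_apply _ (by fun_prop)] at hmap
  rw [hU, ← integral_map (φ := fun U : ℕ → ℕ × ℕ => U (n + 1)) (f := f)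
    (measurable_pi_apply _).aemeasurable
    (StronglyMeasurable.of_discrete).aestronglyMeasurable, hmap]
  rfl

theorem integral_urnLaw_zero (a b c d : ℕ) (v : ℕ × ℕ) (f : ℕ × ℕ → E) :
    ∫ U, f (U 0) ∂(urnLaw a b c d v.1 v.2) = f v := by
  rw [integral_congr_ae (g := fun _ => f v)]
  · simp
  · filter_upwards [ae_urnLaw_zero a b c d v] with U hU
    rw [hU]

theorem integral_urnLaw_succ (a b c d : ℕ) (v : ℕ × ℕ) (f : ℕ × ℕ → E) (n : ℕ) :
    ∫ U, f (U (n + 1)) ∂(urnLaw a b c d v.1 v.2) =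
      ∫ U, ∫ w, f w ∂(stepKernel a b c d (U n)) ∂(urnLaw a b c d v.1 v.2) := by
  rw [← integral_condExp (Filtration.le (Filtration.piLE (X := fun _ => ℕ × ℕ)) n),
    integral_congr_ae (condExp_urnLaw a b c d v f n)]

theorem integral_urnLaw_eq_iterate (a b c d : ℕ) (v : ℕ × ℕ) (f : ℕ × ℕ → E) (n : ℕ) :
    ∫ U, f (U n) ∂(urnLaw a b c d v.1 v.2) =
      (fun (g : ℕ × ℕ → E) u => ∫ w, g w ∂(stepKernel a b c d u))^[n] f v := by
  induction n generalizing f with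
  | zero => exact integral_urnLaw_zero a b c d v f
  | succ n ih =>
    rw [integral_urnLaw_succ, Function.iterate_succ_apply]
    exact ih fun u => ∫ w, f w ∂(stepKernel a b c d u)

theorem integral_urnLaw_succ_eq_integral_stepKernel (a b c d : ℕ) (v : ℕ × ℕ) (f : ℕ × ℕ → E)
    (n : ℕ) :
    ∫ U, f (U (n + 1)) ∂(urnLaw a b c d v.1 v.2) =
      ∫ w, ∫ U, f (U n) ∂(urnLaw a b c d w.1 w.2) ∂(stepKernel a b c d v) := by
  rw [integral_urnLaw_eq_iterate, Function.iterate_succ_apply']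
  simp only [integral_urnLaw_eq_iterate]

end Chain

section Balanced

/-- The number of balls in an urn, in units of the number `a + b` of balls added at each step. -/
noncomputable def mass (a b : ℕ) : ℕ × ℕ →+ ℝ where
  toFun v := ((v.1 : ℝ) + v.2) / ((a : ℝ) + b)
  map_zero' := by simp
  map_add' v w := by
    simp only [Prod.fst_add, Prod.snd_add]
    push_cast
    ring

/-- The replacement matrix `(a b; c d)` is balanced: the same positive number of balls is added
at each step. -/
structure IsBalanced (a b c d : ℕ) : Prop where
  add_eq : a + b = c + d
  pos : 0 < a + b

variable {a b c d : ℕ} {v : ℕ × ℕ}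

theorem mass_apply (a b : ℕ) (v : ℕ × ℕ) : mass a b v = ((v.1 : ℝ) + v.2) / ((a : ℝ) + b) := rfl

theorem mass_nonneg (a b : ℕ) (v : ℕ × ℕ) : 0 ≤ mass a b v := by
  rw [mass_apply]
  positivity

theorem ne_zero_of_mass_pos (hv : 0 < mass a b v) : v ≠ 0 := by
  rintro rfl
  simp at hv

theorem IsBalanced.add_cast_pos (h : IsBalanced a b c d) : 0 < (a : ℝ) + b := by
  exact_mod_cast h.pos

theorem IsBalanced.cast_d (h : IsBalanced a b c d) : (d : ℝ) = a + b - c := by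
  have : (a : ℝ) + b = c + d := by exact_mod_cast h.add_eq
  linarith

theorem IsBalanced.mass_pos (h : IsBalanced a b c d) (hv : v ≠ 0) : 0 < mass a b v :=
  div_pos (cast_add_cast_pos hv) h.add_cast_pos

theorem IsBalanced.mass_red (h : IsBalanced a b c d) : mass a b (a, b) = 1 :=
  div_self h.add_cast_pos.ne'

theorem IsBalanced.mass_black (h : IsBalanced a b c d) : mass a b (c, d) = 1 := by
  rw [mass_apply, h.cast_d, add_sub_cancel, div_self h.add_cast_pos.ne']

theorem IsBalanced.add_red_ne_zero (h : IsBalanced a b c d) (v : ℕ × ℕ) : v + (a, b) ≠ 0 := by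
  refine ne_zero_of_mass_pos (a := a) (b := b) ?_
  rw [map_add, h.mass_red]
  linarith [mass_nonneg a b v]

theorem IsBalanced.add_black_ne_zero (h : IsBalanced a b c d) (v : ℕ × ℕ) : v + (c, d) ≠ 0 := by
  refine ne_zero_of_mass_pos (a := a) (b := b) ?_
  rw [map_add, h.mass_black]
  linarith [mass_nonneg a b v]

theorem IsBalanced.ae_mass_stepKernel (h : IsBalanced a b c d) (hv : v ≠ 0) :
    ∀ᵐ w ∂(stepKernel a b c d v), w ≠ 0 ∧ mass a b w = mass a b v + 1 :=
  ae_stepKernel_of_forall hv ⟨h.add_red_ne_zero v, by rw [map_add, h.mass_red]⟩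
    ⟨h.add_black_ne_zero v, by rw [map_add, h.mass_black]⟩

theorem IsBalanced.ae_mass_urnLaw (h : IsBalanced a b c d) (hv : v ≠ 0) (n : ℕ) :
    ∀ᵐ U ∂(urnLaw a b c d v.1 v.2), U n ≠ 0 ∧ mass a b (U n) = mass a b v + n := by
  induction n with
  | zero =>
    filter_upwards [ae_urnLaw_zero a b c d v] with U hU
    simp [hU, hv]
  | succ n ih =>
    refine ae_urnLaw_succ (p := fun w => w ≠ 0 ∧ mass a b w = mass a b v + (n + 1 : ℕ)) ?_
    filter_upwards [ih] with U hU
    filter_upwards [h.ae_mass_stepKernel hU.1] with w hw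
    refine ⟨hw.1, ?_⟩
    rw [hw.2, hU.2]
    push_cast
    ring

theorem IsBalanced.integral_urnLaw_le (h : IsBalanced a b c d) {f : ℕ × ℕ → ℝ} {s : ℝ}
    (hs : 0 ≤ s)
    (hf : ∀ w ≠ 0, ∫ u, f u ∂(stepKernel a b c d w) ≤ (1 + s / mass a b w) * f w)
    (hv : v ≠ 0) (n : ℕ) :
    ∫ U, f (U n) ∂(urnLaw a b c d v.1 v.2) ≤ f v * growth s (mass a b v) n := by
  induction n with
  | zero => rw [integral_urnLaw_zero, growth_zero, mul_one]
  | succ n ih =>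
    have hm := h.mass_pos hv
    calc ∫ U, f (U (n + 1)) ∂(urnLaw a b c d v.1 v.2)
        = ∫ U, ∫ w, f w ∂(stepKernel a b c d (U n)) ∂(urnLaw a b c d v.1 v.2) :=
          integral_urnLaw_succ a b c d v f n
      _ ≤ ∫ U, (1 + s / (mass a b v + n)) * f (U n) ∂(urnLaw a b c d v.1 v.2) := by
          refine integral_mono_ae
            (integrable_urnLaw a b c d v (fun w => ∫ u, f u ∂(stepKernel a b c d w)) n)
            ((integrable_urnLaw a b c d v f n).const_mul _) ?_
          filter_upwards [h.ae_mass_urnLaw hv n] with U hU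
          rw [← hU.2]
          exact hf _ hU.1
      _ ≤ (1 + s / (mass a b v + n)) * (f v * growth s (mass a b v) n) := by
          rw [integral_const_mul]
          gcongr
      _ = f v * growth s (mass a b v) (n + 1) := by
          rw [growth_succ]
          ring

theorem IsBalanced.integral_urnLaw_eq (h : IsBalanced a b c d) {f : ℕ × ℕ → ℝ} {s : ℝ}
    (hs : 0 ≤ s)
    (hf : ∀ w ≠ 0, ∫ u, f u ∂(stepKernel a b c d w) = (1 + s / mass a b w) * f w)
    (hv : v ≠ 0) (n : ℕ) :
    ∫ U, f (U n) ∂(urnLaw a b c d v.1 v.2) = f v * growth s (mass a b v) n := by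
  refine le_antisymm (h.integral_urnLaw_le hs (fun w hw => (hf w hw).le) hv n) ?_
  have := h.integral_urnLaw_le (f := fun w => -f w) hs
    (fun w hw => by rw [integral_neg, hf w hw, mul_neg]) hv n
  rw [integral_neg, neg_mul] at this
  exact neg_le_neg_iff.1 this

theorem u₂_add (a b c : ℕ) (v w : ℕ × ℕ) : u₂ a b c (v + w) = u₂ a b c v + u₂ a b c w := by
  simp only [u₂, Prod.fst_add, Prod.snd_add]
  push_cast
  ring

theorem u₂_red (a b c : ℕ) : u₂ a b c (a, b) = ratio a b c * b := by
  rw [u₂, ratio]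
  ring

theorem IsBalanced.u₂_black (h : IsBalanced a b c d) : u₂ a b c (c, d) = -(ratio a b c * c) := by
  simp only [u₂, ratio, h.cast_d]
  ring

theorem IsBalanced.u₂_div_mass (h : IsBalanced a b c d) (hv : v ≠ 0) :
    u₂ a b c v / mass a b v = v.1 / (v.1 + v.2) * b - v.2 / (v.1 + v.2) * c := by
  have := h.add_cast_pos
  have := cast_add_cast_pos hv
  rw [u₂, mass_apply]
  field_simp

theorem div_add_div_cast_add (hv : v ≠ 0) :
    (v.1 : ℝ) / (v.1 + v.2) + (v.2 : ℝ) / (v.1 + v.2) = 1 := by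
  rw [← add_div, div_self (cast_add_cast_pos hv).ne']

theorem IsBalanced.integral_u₂_stepKernel (h : IsBalanced a b c d) (hv : v ≠ 0) :
    ∫ w, u₂ a b c w ∂(stepKernel a b c d v) =
      (1 + ratio a b c / mass a b v) * u₂ a b c v := by
  have hu := h.u₂_div_mass hv
  have hprob := div_add_div_cast_add hv
  simp only [integral_stepKernel a b c d _ hv, u₂_add, u₂_red, h.u₂_black, smul_eq_mul]
  linear_combination u₂ a b c v * hprob - ratio a b c * hu

theorem IsBalanced.integral_u₂_sq_stepKernel_le (h : IsBalanced a b c d) (hv : v ≠ 0) :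
    ∫ w, u₂ a b c w ^ 2 ∂(stepKernel a b c d v) ≤
      (1 + 2 * ratio a b c / mass a b v) * u₂ a b c v ^ 2
        + ((b : ℝ) ^ 2 + (c : ℝ) ^ 2) * ratio a b c ^ 2 := by
  have hu := h.u₂_div_mass hv
  have hprob := div_add_div_cast_add hv
  simp only [integral_stepKernel a b c d _ hv, u₂_add, u₂_red, h.u₂_black, smul_eq_mul]
  set p := (v.1 : ℝ) / (v.1 + v.2)
  set q := (v.2 : ℝ) / (v.1 + v.2)
  have hp : 0 ≤ p := by positivity
  have hq : 0 ≤ q := by positivity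
  have hjump : (p * (b : ℝ) ^ 2 + q * (c : ℝ) ^ 2) * ratio a b c ^ 2 ≤
      ((b : ℝ) ^ 2 + (c : ℝ) ^ 2) * ratio a b c ^ 2 := by
    gcongr
    · exact mul_le_of_le_one_left (by positivity) (by linarith)
    · exact mul_le_of_le_one_left (by positivity) (by linarith)
  linear_combination hjump + u₂ a b c v ^ 2 * hprob - 2 * ratio a b c * u₂ a b c v * hu

end Balanced

section Large

/-- The replacement matrix `(a b; c d)` is balanced and its eigenvalue ratio exceeds `1 / 2`. -/
structure IsLarge (a b c d : ℕ) : Prop where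
  add_eq : a + b = c + d
  half_lt_ratio : 1 / 2 < ratio a b c

/-- The constant `A` for which `u₂ ^ 2 + A * mass` is superharmonic up to the factor
`1 + 2 * σ / mass`. -/
noncomputable def varianceConst (a b c : ℕ) : ℝ :=
  ((b : ℝ) ^ 2 + (c : ℝ) ^ 2) * ratio a b c ^ 2 / (2 * ratio a b c - 1)

/-- The Lyapunov function `u₂ ^ 2 + A * mass`, which controls the second moment of `u₂`. -/
noncomputable def energy (a b c : ℕ) (v : ℕ × ℕ) : ℝ :=
  u₂ a b c v ^ 2 + varianceConst a b c * mass a b v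

variable {a b c d : ℕ} {v : ℕ × ℕ}

theorem IsLarge.ratio_pos (h : IsLarge a b c d) : 0 < ratio a b c := by
  linarith [h.half_lt_ratio]

theorem IsLarge.isBalanced (h : IsLarge a b c d) : IsBalanced a b c d := by
  refine ⟨h.add_eq, Nat.pos_of_ne_zero fun h0 => h.ratio_pos.ne' ?_⟩
  have : (a : ℝ) + b = 0 := by exact_mod_cast h0
  rw [ratio, this, div_zero]

theorem IsLarge.varianceConst_nonneg (h : IsLarge a b c d) : 0 ≤ varianceConst a b c :=
  div_nonneg (by positivity) (by linarith [h.half_lt_ratio])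

theorem IsLarge.integral_energy_stepKernel_le (h : IsLarge a b c d) (hv : v ≠ 0) :
    ∫ w, energy a b c w ∂(stepKernel a b c d v) ≤
      (1 + 2 * ratio a b c / mass a b v) * energy a b c v := by
  have hm := h.isBalanced.mass_pos hv
  have hmass : ∫ w, mass a b w ∂(stepKernel a b c d v) = mass a b v + 1 := by
    rw [integral_congr_ae ((h.isBalanced.ae_mass_stepKernel hv).mono fun _ hw => hw.2),
      integral_const, probReal_univ, one_smul]
  have hsq := h.isBalanced.integral_u₂_sq_stepKernel_le hv
  have hA : ((b : ℝ) ^ 2 + (c : ℝ) ^ 2) * ratio a b c ^ 2 =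
      varianceConst a b c * (2 * ratio a b c - 1) :=
    (div_mul_cancel₀ _ (by linarith [h.half_lt_ratio])).symm
  have hA' : 2 * ratio a b c / mass a b v * (varianceConst a b c * mass a b v) =
      2 * ratio a b c * varianceConst a b c := by
    field_simp
  simp only [energy]
  rw [integral_add (integrable_stepKernel ..) (integrable_stepKernel ..), integral_const_mul,
    hmass]
  linear_combination hsq + hA - hA'

theorem IsLarge.integral_u₂_urnLaw (h : IsLarge a b c d) (hv : v ≠ 0) (n : ℕ) :
    ∫ U, u₂ a b c (U n) ∂(urnLaw a b c d v.1 v.2) =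
      u₂ a b c v * growth (ratio a b c) (mass a b v) n :=
  h.isBalanced.integral_urnLaw_eq h.ratio_pos.le
    (fun _ => h.isBalanced.integral_u₂_stepKernel) hv n

theorem IsLarge.integral_u₂_sq_urnLaw_le (h : IsLarge a b c d) (hv : v ≠ 0) (n : ℕ) :
    ∫ U, u₂ a b c (U n) ^ 2 ∂(urnLaw a b c d v.1 v.2) ≤
      energy a b c v * growth (2 * ratio a b c) (mass a b v) n := by
  refine (integral_mono (integrable_urnLaw a b c d v (fun w => u₂ a b c w ^ 2) n)
    (integrable_urnLaw a b c d v (energy a b c) n) fun U => ?_).trans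
    (h.isBalanced.integral_urnLaw_le (by linarith [h.ratio_pos])
      (fun _ => h.integral_energy_stepKernel_le) hv n)
  exact le_add_of_nonneg_right (mul_nonneg h.varianceConst_nonneg (mass_nonneg a b _))

theorem IsLarge.hasMoments_u₂_div (h : IsLarge a b c d) (hv : v ≠ 0) (n : ℕ) (k : ℝ) :
    HasMoments ((urnLaw a b c d v.1 v.2).map fun U => u₂ a b c (U n) / k)
      (u₂ a b c v * (growth (ratio a b c) (mass a b v) n / k))
      (energy a b c v * (growth (2 * ratio a b c) (mass a b v) n / k ^ 2)) := by
  rw [hasMoments_map_iff (integrable_urnLaw a b c d v (fun w => u₂ a b c w / k) n).aemeasurable]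
  refine ⟨memLp_urnLaw a b c d v (fun w => u₂ a b c w / k) n, ?_, ?_⟩
  · rw [integral_div, h.integral_u₂_urnLaw hv, mul_div_assoc]
  · simp only [div_pow]
    rw [integral_div, ← mul_div_assoc]
    gcongr
    exact h.integral_u₂_sq_urnLaw_le hv n

end Large

section Convergence

variable {a b c d : ℕ} {v : ℕ × ℕ}

theorem IsLarge.martingale_u₂_div_growth (h : IsLarge a b c d) (hv : v ≠ 0) :
    Martingale (fun n (U : ℕ → ℕ × ℕ) => u₂ a b c (U n) / growth (ratio a b c) (mass a b v) n)
      (Filtration.piLE (X := fun _ => ℕ × ℕ)) (urnLaw a b c d v.1 v.2) := by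
  have hr := h.ratio_pos
  have hm := h.isBalanced.mass_pos hv
  refine martingale_nat (fun n => ?_) (fun n => ?_) fun n => ?_
  · have hcoord : Measurable[Filtration.piLE (X := fun _ => ℕ × ℕ) n]
        (fun U : ℕ → ℕ × ℕ => U n) := by
      rw [Filtration.piLE_eq_comap_frestrictLe]
      exact (measurable_pi_apply (X := fun _ : Finset.Iic n => ℕ × ℕ) ⟨n, by simp⟩).comp
        (comap_measurable _)
    exact (StronglyMeasurable.of_discrete (f := fun w : ℕ × ℕ =>
      u₂ a b c w / growth (ratio a b c) (mass a b v) n)).comp_measurable hcoord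
  · exact (integrable_urnLaw a b c d v (u₂ a b c) n).div_const _
  · refine EventuallyEq.symm ?_
    filter_upwards [h.isBalanced.ae_mass_urnLaw hv n, condExp_urnLaw a b c d v
      (fun w => u₂ a b c w / growth (ratio a b c) (mass a b v) (n + 1)) n] with U hU hcond
    have hg := growth_pos hm (by positivity : 0 < mass a b v + ratio a b c) n
    have : 0 < 1 + ratio a b c / (mass a b v + n) := by positivity
    rw [hcond, integral_div, h.isBalanced.integral_u₂_stepKernel hU.1, hU.2, growth_succ]
    field_simp

theorem IsLarge.integral_abs_u₂_div_growth_le (h : IsLarge a b c d) (hv : v ≠ 0) (n : ℕ) :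
    ∫ U, |u₂ a b c (U n) / growth (ratio a b c) (mass a b v) n| ∂(urnLaw a b c d v.1 v.2) ≤
      √(energy a b c v) := by
  have hr := h.ratio_pos
  have hm := h.isBalanced.mass_pos hv
  set g := growth (ratio a b c) (mass a b v) n
  have henergy : 0 ≤ energy a b c v :=
    add_nonneg (sq_nonneg _) (mul_nonneg h.varianceConst_nonneg hm.le)
  obtain ⟨hmem, -, hsq⟩ := (hasMoments_map_iff
    (integrable_urnLaw a b c d v (fun w => u₂ a b c w / g) n).aemeasurable).1
      (h.hasMoments_u₂_div hv n g)
  refine (integral_abs_le_sqrt hmem).trans (Real.sqrt_le_sqrt (hsq.trans ?_))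
  refine mul_le_of_le_one_right henergy (div_le_one_of_le₀ ?_ (sq_nonneg g))
  exact growth_two_mul_le hm hr.le n

theorem IsLarge.ae_exists_tendsto_scaled (h : IsLarge a b c d) (hv : v ≠ 0) :
    ∀ᵐ U ∂(urnLaw a b c d v.1 v.2), ∃ w : ℝ, Tendsto (scaled a b c U) atTop (𝓝 w) := by
  have hr := h.ratio_pos
  have hm := h.isBalanced.mass_pos hv
  have hM := h.martingale_u₂_div_growth hv
  have hbdd (n : ℕ) : eLpNorm
      (fun U : ℕ → ℕ × ℕ => u₂ a b c (U n) / growth (ratio a b c) (mass a b v) n) 1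
      (urnLaw a b c d v.1 v.2) ≤ ((√(energy a b c v)).toNNReal : ℝ≥0∞) := by
    rw [eLpNorm_one_eq_lintegral_enorm, ← ofReal_integral_norm_eq_lintegral_enorm
      (hM.integrable n)]
    exact ENNReal.ofReal_le_ofReal (h.integral_abs_u₂_div_growth_le hv n)
  filter_upwards [hM.submartingale.exists_ae_tendsto_of_bdd hbdd] with U ⟨w, hw⟩
  refine ⟨w * gammaQuotient (ratio a b c) (mass a b v),
    (hw.mul (tendsto_growth_div_rpow hm (by positivity))).congr fun n => ?_⟩
  exact div_mul_div_cancel₀ (growth_pos hm (by positivity) n).ne'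

end Convergence

section LimitLaw

variable {a b c d : ℕ} {v : ℕ × ℕ}

theorem IsLarge.ae_tendsto_limUnder (h : IsLarge a b c d) (hv : v ≠ 0) :
    ∀ᵐ U ∂(urnLaw a b c d v.1 v.2),
      Tendsto (scaled a b c U) atTop (𝓝 (limUnder atTop (scaled a b c U))) := by
  filter_upwards [h.ae_exists_tendsto_scaled hv] with U hU using tendsto_nhds_limUnder hU

theorem measurable_scaled (a b c n : ℕ) :
    Measurable (fun U : ℕ → ℕ × ℕ => scaled a b c U n) :=
  (Measurable.of_discrete (f := fun w : ℕ × ℕ => u₂ a b c w / (n : ℝ) ^ ratio a b c)).comp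
    (measurable_pi_apply n)

theorem IsLarge.aemeasurable_limUnder (h : IsLarge a b c d) (hv : v ≠ 0) :
    AEMeasurable (fun U => limUnder atTop (scaled a b c U)) (urnLaw a b c d v.1 v.2) :=
  aemeasurable_of_tendsto_metrizable_ae atTop (fun n => (measurable_scaled a b c n).aemeasurable)
    (h.ae_tendsto_limUnder hv)

theorem IsLarge.isProbabilityMeasure_limitLaw (h : IsLarge a b c d) (hv : v ≠ 0) :
    IsProbabilityMeasure (limitLaw a b c d v.1 v.2) :=
  Measure.isProbabilityMeasure_map (h.aemeasurable_limUnder hv)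

theorem IsLarge.hasMoments_limitLaw (h : IsLarge a b c d) (hv : v ≠ 0) :
    HasMoments (limitLaw a b c d v.1 v.2)
      (u₂ a b c v * gammaQuotient (ratio a b c) (mass a b v))
      (energy a b c v * gammaQuotient (2 * ratio a b c) (mass a b v)) := by
  have hr := h.ratio_pos
  have hm := h.isBalanced.mass_pos hv
  have hsq (n : ℕ) : ((n : ℝ) ^ ratio a b c) ^ 2 = (n : ℝ) ^ (2 * ratio a b c) := by
    rw [mul_comm, Real.rpow_mul n.cast_nonneg, Real.rpow_two]
  refine .of_tendsto_ae (fun n => (measurable_scaled a b c n).aemeasurable)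
    (fun n => h.hasMoments_u₂_div hv n ((n : ℝ) ^ ratio a b c)) (h.ae_tendsto_limUnder hv)
    ((tendsto_growth_div_rpow hm (by positivity)).const_mul _) ?_
  simp only [hsq]
  exact (tendsto_growth_div_rpow hm (by positivity)).const_mul _

theorem IsLarge.tendsto_integral_exp_u₂ (h : IsLarge a b c d) (hv : v ≠ 0) {κ : ℕ → ℝ} {t : ℝ}
    (hκ : Tendsto (fun n : ℕ => κ n * (n : ℝ) ^ ratio a b c) atTop (𝓝 t)) :
    Tendsto (fun n => ∫ U, Complex.exp (↑(κ n * u₂ a b c (U n)) * Complex.I)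
      ∂(urnLaw a b c d v.1 v.2)) atTop (𝓝 (charFun (limitLaw a b c d v.1 v.2) t)) := by
  rw [charFun_apply_real, limitLaw, integral_map (h.aemeasurable_limUnder hv) (by fun_prop)]
  refine tendsto_integral_of_dominated_convergence (fun _ => (1 : ℝ)) (fun n => ?_)
    (integrable_const _) (fun n => .of_forall fun U => ?_) ?_
  · have hint := integrable_urnLaw a b c d v
      (fun w => Complex.exp (↑(κ n * u₂ a b c w) * Complex.I)) n
    exact hint.aestronglyMeasurable
  · rw [Complex.norm_exp_ofReal_mul_I]
  · filter_upwards [h.ae_tendsto_limUnder hv] with U hU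
    have hphase : Tendsto (fun n => κ n * u₂ a b c (U n)) atTop
        (𝓝 (t * limUnder atTop (scaled a b c U))) := by
      refine (hκ.mul hU).congr' ?_
      filter_upwards [eventually_gt_atTop 0] with n hn
      have : (n : ℝ) ^ ratio a b c ≠ 0 := by positivity
      rw [scaled]
      field_simp
    rw [← Complex.ofReal_mul]
    exact ((by fun_prop : Continuous fun x : ℝ => Complex.exp (x * Complex.I)).tendsto _).comp
      hphase

theorem IsLarge.charFun_limitLaw_eq_integral_stepKernel (h : IsLarge a b c d) (hv : v ≠ 0)
    (t : ℝ) :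
    charFun (limitLaw a b c d v.1 v.2) t =
      ∫ w, charFun (limitLaw a b c d w.1 w.2) t ∂(stepKernel a b c d v) := by
  set κ : ℕ → ℝ := fun n => t / (n : ℝ) ^ ratio a b c
  have hκ : Tendsto (fun n : ℕ => κ n * (n : ℝ) ^ ratio a b c) atTop (𝓝 t) := by
    refine tendsto_const_nhds.congr' ?_
    filter_upwards [eventually_gt_atTop 0] with n hn
    exact (div_mul_cancel₀ t (by positivity)).symm
  have hκ_succ : Tendsto (fun n : ℕ => κ (n + 1) * (n : ℝ) ^ ratio a b c) atTop (𝓝 t) := by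
    have hquot : Tendsto (fun n : ℕ => t * ((n : ℝ) / (n + 1)) ^ ratio a b c) atTop
        (𝓝 (t * 1 ^ ratio a b c)) :=
      ((tendsto_natCast_div_add_atTop (1 : ℝ)).rpow_const (Or.inl one_ne_zero)).const_mul t
    rw [Real.one_rpow, mul_one] at hquot
    refine hquot.congr fun n => ?_
    rw [Real.div_rpow (by positivity) (by positivity)]
    push_cast [κ]
    ring
  have hstart := (h.tendsto_integral_exp_u₂ hv hκ).comp (tendsto_add_atTop_nat 1)
  have hred := h.tendsto_integral_exp_u₂ (h.isBalanced.add_red_ne_zero v) hκ_succ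
  have hblack := h.tendsto_integral_exp_u₂ (h.isBalanced.add_black_ne_zero v) hκ_succ
  rw [integral_stepKernel a b c d _ hv]
  refine tendsto_nhds_unique hstart (((hred.const_smul _).add (hblack.const_smul _)).congr
    fun n => ?_)
  rw [← integral_stepKernel a b c d
    (fun w => ∫ U, Complex.exp (↑(κ (n + 1) * u₂ a b c (U n)) * Complex.I)
      ∂(urnLaw a b c d w.1 w.2)) hv]
  exact (integral_urnLaw_succ_eq_integral_stepKernel a b c d v
    (fun w => Complex.exp (↑(κ (n + 1) * u₂ a b c w) * Complex.I)) n).symm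

end LimitLaw

section Split

variable {a b c d : ℕ} {v w : ℕ × ℕ}

/-- The law of `B ^ σ * X + (1 - B) ^ σ * Y`, where `B`, `X` and `Y` are independent, `X` and `Y`
have the limit laws of the urns that start from `v` and from `w`, and `B` has the Beta law whose
parameters are the masses of `v` and `w`. -/
noncomputable def splitLaw (a b c d : ℕ) (v w : ℕ × ℕ) : Measure ℝ :=
  randomCombination (betaMeasure (mass a b v) (mass a b w)) (fun x => x ^ ratio a b c)
    (fun x => (1 - x) ^ ratio a b c) (limitLaw a b c d v.1 v.2) (limitLaw a b c d w.1 w.2)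

theorem add_ne_zero_of_left (hv : v ≠ 0) (w : ℕ × ℕ) : v + w ≠ 0 :=
  fun h => hv (add_eq_zero.1 h).1

theorem IsLarge.isProbabilityMeasure_splitLaw (h : IsLarge a b c d) (hv : v ≠ 0) (hw : w ≠ 0) :
    IsProbabilityMeasure (splitLaw a b c d v w) := by
  have := h.isProbabilityMeasure_limitLaw hv
  have := h.isProbabilityMeasure_limitLaw hw
  have := isProbabilityMeasureBeta (h.isBalanced.mass_pos hv) (h.isBalanced.mass_pos hw)
  exact isProbabilityMeasure_randomCombination (by fun_prop) (by fun_prop)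

theorem IsLarge.charFun_splitLaw (h : IsLarge a b c d) (hv : v ≠ 0) (hw : w ≠ 0) (t : ℝ) :
    charFun (splitLaw a b c d v w) t =
      ∫ x, charFun (limitLaw a b c d v.1 v.2) (t * x ^ ratio a b c) *
        charFun (limitLaw a b c d w.1 w.2) (t * (1 - x) ^ ratio a b c)
        ∂(betaMeasure (mass a b v) (mass a b w)) := by
  have := h.isProbabilityMeasure_limitLaw hv
  have := h.isProbabilityMeasure_limitLaw hw
  have := isProbabilityMeasureBeta (h.isBalanced.mass_pos hv) (h.isBalanced.mass_pos hw)
  exact charFun_randomCombination (by fun_prop) (by fun_prop) t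

theorem IsLarge.hasMoments_splitLaw (h : IsLarge a b c d) (hv : v ≠ 0) (hw : w ≠ 0) :
    HasMoments (splitLaw a b c d v w)
      (u₂ a b c (v + w) * gammaQuotient (ratio a b c) (mass a b (v + w)))
      (energy a b c (v + w) * gammaQuotient (2 * ratio a b c) (mass a b (v + w))) := by
  have := h.isProbabilityMeasure_limitLaw hv
  have := h.isProbabilityMeasure_limitLaw hw
  have hσ := h.ratio_pos
  have hp := h.isBalanced.mass_pos hv
  have hq := h.isBalanced.mass_pos hw
  have := isProbabilityMeasureBeta hp hq
  have hmoments := (h.hasMoments_limitLaw hv).randomCombination (h.hasMoments_limitLaw hw)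
    (memLp_two_rpow_betaMeasure (s := ratio a b c) hp hq (by positivity))
    (memLp_two_one_sub_rpow_betaMeasure (s := ratio a b c) hp hq (by positivity))
  rw [integral_rpow_betaMeasure hp hq (by positivity),
    integral_one_sub_rpow_betaMeasure hp hq (by positivity),
    integral_rpow_mul_rpow_betaMeasure hp hq (by positivity) (by positivity),
    integral_congr_ae (ae_rpow_sq_betaMeasure _ _ _),
    integral_congr_ae (ae_one_sub_rpow_sq_betaMeasure _ _ _),
    integral_rpow_betaMeasure hp hq (by positivity),
    integral_one_sub_rpow_betaMeasure hp hq (by positivity), ← two_mul] at hmoments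
  have hGp := gammaQuotient_pos (s := ratio a b c) hp (by positivity)
  have hGq := gammaQuotient_pos (s := ratio a b c) hq (by positivity)
  have hGp2 := gammaQuotient_pos (s := 2 * ratio a b c) hp (by positivity)
  have hGq2 := gammaQuotient_pos (s := 2 * ratio a b c) hq (by positivity)
  rw [splitLaw, energy, map_add, u₂_add]
  convert hmoments using 1
  · field_simp
  · rw [energy, energy]
    field_simp
    ring

/-- A bound on the variances of the limit laws of the urns that start with mass `τ`. -/
noncomputable def varianceBound (a b c : ℕ) (τ : ℝ) : ℝ :=
  varianceConst a b c * (τ * gammaQuotient (2 * ratio a b c) τ)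

theorem IsLarge.tendsto_varianceBound (h : IsLarge a b c d) {τ : ℝ} (hτ : 0 < τ) :
    Tendsto (fun n : ℕ => varianceBound a b c (τ + n)) atTop (𝓝 0) := by
  simpa only [mul_zero, varianceBound] using
    (tendsto_mul_gammaQuotient hτ (by linarith [h.half_lt_ratio])).const_mul (varianceConst a b c)

theorem IsLarge.energy_mul_sub_sq_le (h : IsLarge a b c d) (hv : v ≠ 0) :
    energy a b c v * gammaQuotient (2 * ratio a b c) (mass a b v)
        - (u₂ a b c v * gammaQuotient (ratio a b c) (mass a b v)) ^ 2 ≤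
      varianceBound a b c (mass a b v) := by
  have hG := mul_le_mul_of_nonneg_left
    (gammaQuotient_two_mul_le (h.isBalanced.mass_pos hv) h.ratio_pos.le)
    (sq_nonneg (u₂ a b c v))
  rw [varianceBound, energy]
  linear_combination hG

theorem IsLarge.norm_charFun_limitLaw_add_sub_splitLaw_le (h : IsLarge a b c d) (hv : v ≠ 0)
    (hw : w ≠ 0) (t : ℝ) :
    ‖charFun (limitLaw a b c d (v + w).1 (v + w).2) t - charFun (splitLaw a b c d v w) t‖ ≤
      2 * (|t| * √(varianceBound a b c (mass a b (v + w)))) := by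
  have hvw := add_ne_zero_of_left hv w
  have := h.isProbabilityMeasure_limitLaw hvw
  have := h.isProbabilityMeasure_splitLaw hv hw
  refine ((h.hasMoments_limitLaw hvw).norm_charFun_sub_charFun_le
    (h.hasMoments_splitLaw hv hw) t).trans ?_
  gcongr
  exact h.energy_mul_sub_sq_le hvw

end Split

section Harmonic

variable {a b c d : ℕ} {v w : ℕ × ℕ}

theorem integral_integral_stepKernel {Ω E : Type*} [MeasurableSpace Ω] {ρ : Measure Ω}
    [NormedAddCommGroup E] [NormedSpace ℝ E] [CompleteSpace E] {g : ℕ × ℕ → Ω → E}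
    (hg : ∀ u, Integrable (g u) ρ) (hv : v ≠ 0) :
    ∫ x, ∫ u, g u x ∂(stepKernel a b c d v) ∂ρ =
      ∫ u, ∫ x, g u x ∂ρ ∂(stepKernel a b c d v) := by
  simp only [integral_stepKernel a b c d _ hv]
  rw [integral_add (by exact (hg _).smul _) (by exact (hg _).smul _), integral_smul,
    integral_smul]

-- The ball drawn from an urn with composition `v + w` belongs to the part `v` with probability
-- `mass v / (mass v + mass w)`.
theorem IsBalanced.integral_stepKernel_add {E : Type*} [NormedAddCommGroup E] [NormedSpace ℝ E]
    [CompleteSpace E] (h : IsBalanced a b c d) (hv : v ≠ 0) (hw : w ≠ 0) (f : ℕ × ℕ → E) :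
    ∫ u, f u ∂(stepKernel a b c d (v + w)) =
      (mass a b v / (mass a b v + mass a b w)) • ∫ v', f (v' + w) ∂(stepKernel a b c d v)
        + (mass a b w / (mass a b v + mass a b w)) •
          ∫ w', f (v + w') ∂(stepKernel a b c d w) := by
  have hS := h.add_cast_pos
  have hv' := cast_add_cast_pos hv
  have hw' := cast_add_cast_pos hw
  have hweight_v (k : ℝ) : mass a b v / (mass a b v + mass a b w) * (k / (v.1 + v.2)) =
      k / (v.1 + w.1 + (v.2 + w.2)) := by
    rw [mass_apply, mass_apply, add_add_add_comm, div_mul_div_comm]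
    field_simp
  have hweight_w (k : ℝ) : mass a b w / (mass a b v + mass a b w) * (k / (w.1 + w.2)) =
      k / (v.1 + w.1 + (v.2 + w.2)) := by
    rw [mass_apply, mass_apply, add_add_add_comm, div_mul_div_comm]
    field_simp
  simp only [integral_stepKernel a b c d _ hv, integral_stepKernel a b c d _ hw,
    integral_stepKernel a b c d _ (add_ne_zero_of_left hv w), smul_add, smul_smul, hweight_v,
    hweight_w, add_right_comm v _ w, add_assoc v w, Prod.fst_add, Prod.snd_add, Nat.cast_add,
    add_div, add_smul]
  abel

instance (a b c d α β : ℕ) : IsFiniteMeasure (limitLaw a b c d α β) := by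
  unfold limitLaw
  infer_instance

theorem integrable_charFun_mul_charFun {Ω : Type*} [MeasurableSpace Ω] {ρ : Measure Ω}
    [IsFiniteMeasure ρ] {μ ν : Measure ℝ} [IsFiniteMeasure μ] [IsFiniteMeasure ν] {f g : Ω → ℝ}
    (hf : Measurable f) (hg : Measurable g) :
    Integrable (fun ω => charFun μ (f ω) * charFun ν (g ω)) ρ := by
  refine .of_bound (C := μ.real Set.univ * ν.real Set.univ) ?_ (.of_forall fun ω => ?_)
  · exact ((measurable_charFun.comp hf).mul (measurable_charFun.comp hg)).aestronglyMeasurable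
  · rw [norm_mul]
    gcongr <;> exact norm_charFun_le _

theorem IsLarge.integral_charFun_splitLaw_left (h : IsLarge a b c d) (hv : v ≠ 0) (hw : w ≠ 0)
    (t : ℝ) :
    ∫ v', charFun (splitLaw a b c d v' w) t ∂(stepKernel a b c d v) =
      ∫ x, charFun (limitLaw a b c d v.1 v.2) (t * x ^ ratio a b c) *
        charFun (limitLaw a b c d w.1 w.2) (t * (1 - x) ^ ratio a b c)
        ∂(betaMeasure (mass a b v + 1) (mass a b w)) := by
  have hp := h.isBalanced.mass_pos hv
  have hq := h.isBalanced.mass_pos hw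
  have := isProbabilityMeasureBeta (by positivity : 0 < mass a b v + 1) hq
  simp only [h.charFun_limitLaw_eq_integral_stepKernel hv, ← integral_mul_const]
  rw [integral_integral_stepKernel
    (fun u => integrable_charFun_mul_charFun (by fun_prop) (by fun_prop)) hv]
  refine integral_congr_ae ?_
  filter_upwards [h.isBalanced.ae_mass_stepKernel hv] with v' hv'
  rw [h.charFun_splitLaw hv'.1 hw, hv'.2]

theorem IsLarge.integral_charFun_splitLaw_right (h : IsLarge a b c d) (hv : v ≠ 0) (hw : w ≠ 0)
    (t : ℝ) :
    ∫ w', charFun (splitLaw a b c d v w') t ∂(stepKernel a b c d w) =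
      ∫ x, charFun (limitLaw a b c d v.1 v.2) (t * x ^ ratio a b c) *
        charFun (limitLaw a b c d w.1 w.2) (t * (1 - x) ^ ratio a b c)
        ∂(betaMeasure (mass a b v) (mass a b w + 1)) := by
  have hp := h.isBalanced.mass_pos hv
  have hq := h.isBalanced.mass_pos hw
  have := isProbabilityMeasureBeta hp (by positivity : 0 < mass a b w + 1)
  simp only [h.charFun_limitLaw_eq_integral_stepKernel hw, ← integral_const_mul]
  rw [integral_integral_stepKernel
    (fun u => integrable_charFun_mul_charFun (by fun_prop) (by fun_prop)) hw]
  refine integral_congr_ae ?_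
  filter_upwards [h.isBalanced.ae_mass_stepKernel hw] with w' hw'
  rw [h.charFun_splitLaw hv hw'.1, hw'.2]

theorem IsLarge.charFun_splitLaw_eq_add (h : IsLarge a b c d) (hv : v ≠ 0) (hw : w ≠ 0) (t : ℝ) :
    charFun (splitLaw a b c d v w) t =
      (mass a b v / (mass a b v + mass a b w)) •
          ∫ v', charFun (splitLaw a b c d v' w) t ∂(stepKernel a b c d v)
        + (mass a b w / (mass a b v + mass a b w)) •
          ∫ w', charFun (splitLaw a b c d v w') t ∂(stepKernel a b c d w) := by
  have hp := h.isBalanced.mass_pos hv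
  have hq := h.isBalanced.mass_pos hw
  have := isProbabilityMeasureBeta (by positivity : 0 < mass a b v + 1) hq
  have := isProbabilityMeasureBeta hp (by positivity : 0 < mass a b w + 1)
  rw [h.charFun_splitLaw hv hw, h.integral_charFun_splitLaw_left hv hw,
    h.integral_charFun_splitLaw_right hv hw]
  exact integral_betaMeasure_eq_add hp hq
    (integrable_charFun_mul_charFun (by fun_prop) (by fun_prop))
    (integrable_charFun_mul_charFun (by fun_prop) (by fun_prop))

theorem IsLarge.norm_charFun_limitLaw_add_sub_splitLaw_le_add_nat (h : IsLarge a b c d)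
    (hv : v ≠ 0) (hw : w ≠ 0) (t : ℝ) (n : ℕ) :
    ‖charFun (limitLaw a b c d (v + w).1 (v + w).2) t - charFun (splitLaw a b c d v w) t‖ ≤
      2 * (|t| * √(varianceBound a b c (mass a b (v + w) + n))) := by
  induction n generalizing v w with
  | zero =>
    rw [Nat.cast_zero, add_zero]
    exact h.norm_charFun_limitLaw_add_sub_splitLaw_le hv hw t
  | succ n ih =>
    have hp := h.isBalanced.mass_pos hv
    have hq := h.isBalanced.mass_pos hw
    set C := 2 * (|t| * √(varianceBound a b c (mass a b (v + w) + (n + 1 : ℕ)))) with hC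
    have hleft : ‖∫ v', (charFun (limitLaw a b c d (v' + w).1 (v' + w).2) t
        - charFun (splitLaw a b c d v' w) t) ∂(stepKernel a b c d v)‖ ≤ C := by
      refine (norm_integral_le_of_norm_le_const (C := C) ?_).trans_eq (by simp)
      filter_upwards [h.isBalanced.ae_mass_stepKernel hv] with v' hv'
      refine (ih hv'.1 hw).trans_eq ?_
      rw [hC, map_add, map_add, hv'.2]
      push_cast
      ring_nf
    have hright : ‖∫ w', (charFun (limitLaw a b c d (v + w').1 (v + w').2) t
        - charFun (splitLaw a b c d v w') t) ∂(stepKernel a b c d w)‖ ≤ C := by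
      refine (norm_integral_le_of_norm_le_const (C := C) ?_).trans_eq (by simp)
      filter_upwards [h.isBalanced.ae_mass_stepKernel hw] with w' hw'
      refine (ih hv hw'.1).trans_eq ?_
      rw [hC, map_add, map_add, hw'.2]
      push_cast
      ring_nf
    rw [integral_sub (integrable_stepKernel ..) (integrable_stepKernel ..)] at hleft hright
    rw [h.charFun_limitLaw_eq_integral_stepKernel (add_ne_zero_of_left hv w),
      h.isBalanced.integral_stepKernel_add hv hw, h.charFun_splitLaw_eq_add hv hw,
      add_sub_add_comm, ← smul_sub, ← smul_sub]
    refine mem_closedBall_zero_iff.1 ((convex_closedBall (0 : ℂ) C)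
      (mem_closedBall_zero_iff.2 hleft) (mem_closedBall_zero_iff.2 hright) (by positivity)
      (by positivity) ?_)
    rw [← add_div, div_self (by positivity)]

theorem IsLarge.limitLaw_add (h : IsLarge a b c d) (hv : v ≠ 0) (hw : w ≠ 0) :
    limitLaw a b c d (v + w).1 (v + w).2 = splitLaw a b c d v w := by
  have hvw := add_ne_zero_of_left hv w
  have := h.isProbabilityMeasure_splitLaw hv hw
  refine Measure.ext_of_charFun (funext fun t => ?_)
  have hlim := (((h.tendsto_varianceBound (h.isBalanced.mass_pos hvw)).sqrt).const_mul
    |t|).const_mul 2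
  rw [Real.sqrt_zero, mul_zero, mul_zero] at hlim
  rw [← sub_eq_zero, ← norm_le_zero_iff]
  exact ge_of_tendsto' hlim fun n =>
    h.norm_charFun_limitLaw_add_sub_splitLaw_le_add_nat hv hw t n

end Harmonic

section Dirichlet

variable {n : ℕ}

/-- The set over which `simplexPoint` parametrizes the standard simplex. -/
def cornerSimplex (n : ℕ) : Set (Fin n → ℝ) := {x | (∀ i, 0 ≤ x i) ∧ ∑ i, x i ≤ 1}

/-- The density of the first `n` coordinates of a Dirichlet vector of length `n + 1`. -/
noncomputable def dirichletDensity (ν : Fin (n + 1) → ℝ) : (Fin n → ℝ) → ℝ≥0∞ :=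
  (cornerSimplex n).indicator fun x =>
    ENNReal.ofReal (Real.Gamma (∑ k, ν k) / (∏ k, Real.Gamma (ν k))
      * ∏ k, simplexPoint x k ^ (ν k - 1))

theorem dirichlet_succ (ν : Fin (n + 1) → ℝ) :
    dirichlet (n + 1) ν = (volume.withDensity (dirichletDensity ν)).map simplexPoint := by
  rw [dirichlet]
  congr 2
  ext x
  simp only [dirichletDensity, Set.indicator_apply, cornerSimplex, Set.mem_ofPred_eq]

theorem simplexPoint_castSucc (x : Fin n → ℝ) (i : Fin n) :
    simplexPoint x i.castSucc = x i := Fin.snoc_castSucc ..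

theorem simplexPoint_last (x : Fin n → ℝ) :
    simplexPoint x (Fin.last n) = 1 - ∑ i, x i := Fin.snoc_last ..

theorem simplexPoint_nonneg {x : Fin n → ℝ} (hx : x ∈ cornerSimplex n) (k : Fin (n + 1)) :
    0 ≤ simplexPoint x k := by
  induction k using Fin.lastCases with
  | last => exact simplexPoint_last x ▸ sub_nonneg.2 hx.2
  | cast i => exact simplexPoint_castSucc x i ▸ hx.1 i

theorem simplexPoint_cons (x : ℝ) (y : Fin n → ℝ) :
    simplexPoint (Fin.cons x ((1 - x) • y) : Fin (n + 1) → ℝ) =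
      Fin.cons x ((1 - x) • simplexPoint y) := by
  ext k
  induction k using Fin.lastCases with
  | last =>
    rw [simplexPoint_last, ← Fin.succ_last, Fin.cons_succ, Fin.sum_univ_succ]
    simp only [Fin.cons_zero, Fin.cons_succ, Pi.smul_apply, smul_eq_mul, simplexPoint_last,
      ← Finset.mul_sum]
    ring
  | cast i =>
    rw [simplexPoint_castSucc]
    induction i using Fin.cases with
    | zero => rw [Fin.castSucc_zero, Fin.cons_zero, Fin.cons_zero]
    | succ j =>
      rw [Fin.castSucc_succ, Fin.cons_succ, Fin.cons_succ, Pi.smul_apply, Pi.smul_apply,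
        simplexPoint_castSucc]

theorem cons_mem_cornerSimplex_iff {x : ℝ} (hx : x ∈ Set.Ioo (0 : ℝ) 1) {y : Fin n → ℝ} :
    (Fin.cons x ((1 - x) • y) : Fin (n + 1) → ℝ) ∈ cornerSimplex (n + 1) ↔
      y ∈ cornerSimplex n := by
  have hx' : 0 < 1 - x := sub_pos.2 hx.2
  simp only [cornerSimplex, Set.mem_ofPred_eq, Fin.forall_fin_succ, Fin.sum_univ_succ,
    Fin.cons_zero, Fin.cons_succ, Pi.smul_apply, smul_eq_mul, ← Finset.mul_sum, hx.1.le, true_and,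
    mul_nonneg_iff_of_pos_left hx', ← le_sub_iff_add_le', mul_le_iff_le_one_right hx']

theorem mem_Icc_of_cons_mem_cornerSimplex {x : ℝ} {y : Fin n → ℝ}
    (h : (Fin.cons x y : Fin (n + 1) → ℝ) ∈ cornerSimplex (n + 1)) : x ∈ Set.Icc (0 : ℝ) 1 :=
  ⟨h.1 0, (Finset.single_le_sum (fun i _ => h.1 i) (Finset.mem_univ 0)).trans h.2⟩

theorem measurable_simplexPoint : Measurable (simplexPoint (n := n)) := by
  refine measurable_pi_iff.2 fun k => ?_
  induction k using Fin.lastCases with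
  | last => simp only [simplexPoint_last]; fun_prop
  | cast i => simp only [simplexPoint_castSucc]; fun_prop

theorem measurableSet_cornerSimplex : MeasurableSet (cornerSimplex n) := by
  have hnonneg : MeasurableSet {x : Fin n → ℝ | ∀ i, 0 ≤ x i} := measurableSet_Ici (a := 0)
  exact hnonneg.inter (measurableSet_le
    (Finset.measurable_fun_sum _ fun i _ => measurable_pi_apply i) measurable_const)

theorem measurable_dirichletDensity (ν : Fin (n + 1) → ℝ) : Measurable (dirichletDensity ν) := by
  have hcoord (k : Fin (n + 1)) : Measurable fun x : Fin n → ℝ => simplexPoint x k :=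
    (measurable_pi_apply k).comp measurable_simplexPoint
  refine Measurable.indicator ?_ measurableSet_cornerSimplex
  fun_prop

theorem measurable_cons :
    Measurable (fun p : ℝ × (Fin n → ℝ) => (Fin.cons p.1 p.2 : Fin (n + 1) → ℝ)) := by
  refine measurable_pi_iff.2 fun k => ?_
  induction k using Fin.cases with
  | zero => simp only [Fin.cons_zero]; fun_prop
  | succ i => simp only [Fin.cons_succ]; fun_prop

theorem measurable_cons_smul :
    Measurable (fun p : ℝ × (Fin n → ℝ) =>
      (Fin.cons p.1 ((1 - p.1) • p.2) : Fin (n + 1) → ℝ)) :=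
  measurable_cons.comp (f := fun p : ℝ × (Fin n → ℝ) => (p.1, (1 - p.1) • p.2)) (by fun_prop)

theorem lintegral_dirichlet (ν : Fin (n + 1) → ℝ) {f : (Fin (n + 1) → ℝ) → ℝ≥0∞}
    (hf : Measurable f) :
    ∫⁻ z, f z ∂(dirichlet (n + 1) ν) = ∫⁻ x, dirichletDensity ν x * f (simplexPoint x) := by
  rw [dirichlet_succ, lintegral_map hf measurable_simplexPoint]
  exact lintegral_withDensity_eq_lintegral_mul _ (measurable_dirichletDensity ν)
    (hf.comp measurable_simplexPoint)

theorem ae_dirichlet_nonneg (ν : Fin (n + 1) → ℝ) :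
    ∀ᵐ z ∂(dirichlet (n + 1) ν), ∀ k, 0 ≤ z k := by
  have hmeas : MeasurableSet {z : Fin (n + 1) → ℝ | ∀ k, 0 ≤ z k} := measurableSet_Ici (a := 0)
  rw [dirichlet_succ, ae_map_iff measurable_simplexPoint.aemeasurable hmeas,
    ae_withDensity_iff (measurable_dirichletDensity ν)]
  exact .of_forall fun x hx => simplexPoint_nonneg (Set.mem_of_indicator_ne_zero hx)

theorem sum_tail_pos {ν : Fin (n + 2) → ℝ} (hν : ∀ k, 0 < ν k) : 0 < ∑ k, Fin.tail ν k :=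
  Finset.sum_pos (fun k _ => hν k.succ) Finset.univ_nonempty

theorem gamma_sum_div_prod_gamma {ν : Fin (n + 2) → ℝ} (hν : ∀ k, 0 < ν k) :
    Real.Gamma (∑ k, ν k) / ∏ k, Real.Gamma (ν k) =
      1 / beta (ν 0) (∑ k, Fin.tail ν k) *
        (Real.Gamma (∑ k, Fin.tail ν k) / ∏ k, Real.Gamma (Fin.tail ν k)) := by
  have hsum : ∑ k, ν k = ν 0 + ∑ k, Fin.tail ν k := Fin.sum_univ_succ _
  have hprod : ∏ k, Real.Gamma (ν k) = Real.Gamma (ν 0) * ∏ k, Real.Gamma (Fin.tail ν k) :=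
    Fin.prod_univ_succ _
  have hΓ := Real.Gamma_pos_of_pos (sum_tail_pos hν)
  rw [hsum, hprod, beta]
  field_simp

theorem prod_mul_rpow_sub_one {ι : Type*} [Fintype ι] {r : ℝ} (hr : 0 < r) {z : ι → ℝ}
    (hz : ∀ k, 0 ≤ z k) (ν : ι → ℝ) :
    ∏ k, (r * z k) ^ (ν k - 1) =
      r ^ (∑ k, ν k - Fintype.card ι) * ∏ k, z k ^ (ν k - 1) := by
  have hexponent : ∑ k, ν k - Fintype.card ι = ∑ k, (ν k - 1) := by
    simp [Finset.sum_sub_distrib]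
  rw [hexponent, Real.rpow_sum_of_pos hr, ← Finset.prod_mul_distrib]
  exact Finset.prod_congr rfl fun k _ => Real.mul_rpow hr.le (hz k)

theorem prod_cons_smul_rpow_sub_one {x : ℝ} (hx : x < 1) {z : Fin (n + 1) → ℝ}
    (hz : ∀ k, 0 ≤ z k) (ν : Fin (n + 2) → ℝ) :
    (1 - x) ^ n * ∏ k, (Fin.cons x ((1 - x) • z) : Fin (n + 2) → ℝ) k ^ (ν k - 1) =
      x ^ (ν 0 - 1) * (1 - x) ^ (∑ k, Fin.tail ν k - 1) *
        ∏ k, z k ^ (Fin.tail ν k - 1) := by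
  have hx' : 0 < 1 - x := sub_pos.2 hx
  have hpow : (1 - x) ^ (∑ k, Fin.tail ν k - 1) =
      (1 - x) ^ n * (1 - x) ^ (∑ k, Fin.tail ν k - (n + 1 : ℕ)) := by
    rw [← Real.rpow_natCast, ← Real.rpow_add hx']
    push_cast
    ring_nf
  have hprod := prod_mul_rpow_sub_one hx' hz (Fin.tail ν)
  rw [Fintype.card_fin] at hprod
  simp only [Fin.tail] at hprod hpow ⊢
  simp only [Fin.prod_univ_succ (n := n + 1), Fin.cons_zero, Fin.cons_succ, Pi.smul_apply,
    smul_eq_mul]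
  rw [hpow]
  linear_combination (1 - x) ^ n * x ^ (ν 0 - 1) * hprod

theorem dirichletDensity_cons {ν : Fin (n + 2) → ℝ} (hν : ∀ k, 0 < ν k) {x : ℝ}
    (hx : x ∈ Set.Ioo (0 : ℝ) 1) (y : Fin n → ℝ) :
    ENNReal.ofReal ((1 - x) ^ n) * dirichletDensity ν (Fin.cons x ((1 - x) • y)) =
      betaPDF (ν 0) (∑ k, Fin.tail ν k) x * dirichletDensity (Fin.tail ν) y := by
  by_cases hy : y ∈ cornerSimplex n
  · have hbeta := betaPDFReal_nonneg (hν 0) (sum_tail_pos hν) x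
    have hx' : 0 ≤ 1 - x := sub_nonneg.2 hx.2.le
    rw [dirichletDensity, dirichletDensity, Set.indicator_of_mem hy,
      Set.indicator_of_mem ((cons_mem_cornerSimplex_iff hx).2 hy), betaPDF,
      ← ENNReal.ofReal_mul (by positivity), ← ENNReal.ofReal_mul hbeta, betaPDFReal,
      if_pos (Set.mem_Ioo.1 hx), gamma_sum_div_prod_gamma hν, simplexPoint_cons]
    congr 1
    linear_combination (1 / beta (ν 0) (∑ k, Fin.tail ν k) *
      (Real.Gamma (∑ k, Fin.tail ν k) / ∏ k, Real.Gamma (Fin.tail ν k))) *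
      prod_cons_smul_rpow_sub_one hx.2 (simplexPoint_nonneg hy) ν
  · rw [dirichletDensity, dirichletDensity, Set.indicator_of_notMem hy,
      Set.indicator_of_notMem (mt (cons_mem_cornerSimplex_iff hx).1 hy), mul_zero, mul_zero]

theorem lintegral_eq_mul_lintegral_smul {r : ℝ} (hr : 0 < r) {g : (Fin n → ℝ) → ℝ≥0∞}
    (hg : Measurable g) :
    ∫⁻ y, g y = ENNReal.ofReal (r ^ n) * ∫⁻ y, g (r • y) := by
  rw [← lintegral_map hg (measurable_const_smul r), Measure.map_addHaar_smul volume hr.ne',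
    lintegral_smul_measure, smul_eq_mul, ← mul_assoc, ← ENNReal.ofReal_mul (by positivity),
    Module.finrank_fin_fun, abs_of_pos (by positivity), mul_inv_cancel₀ (by positivity),
    ENNReal.ofReal_one, one_mul]

theorem lintegral_eq_lintegral_lintegral_cons {f : (Fin (n + 1) → ℝ) → ℝ≥0∞}
    (hf : Measurable f) :
    ∫⁻ x, f x = ∫⁻ x, ∫⁻ y : Fin n → ℝ, f (Fin.cons x y) := by
  rw [← (volume_preserving_piFinSuccAbove (fun _ : Fin (n + 1) => ℝ) 0).symm.lintegral_comp hf]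
  simp only [MeasurableEquiv.piFinSuccAbove_symm_apply, Fin.insertNthEquiv, Equiv.coe_fn_mk,
    Fin.insertNth_zero']
  exact lintegral_prod _ (hf.comp measurable_cons).aemeasurable

theorem lintegral_dirichletDensity_cons {ν : Fin (n + 2) → ℝ} (hν : ∀ k, 0 < ν k) {x : ℝ}
    (hx0 : x ≠ 0) (hx1 : x ≠ 1) {f : (Fin (n + 2) → ℝ) → ℝ≥0∞} (hf : Measurable f) :
    ∫⁻ y, dirichletDensity ν (Fin.cons x y) * f (simplexPoint (Fin.cons x y)) =
      betaPDF (ν 0) (∑ k, Fin.tail ν k) x *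
        ∫⁻ z, f (Fin.cons x ((1 - x) • z)) ∂(dirichlet (n + 1) (Fin.tail ν)) := by
  by_cases hx : x ∈ Set.Ioo (0 : ℝ) 1
  · have hdensity : Measurable fun y : Fin n → ℝ =>
        dirichletDensity ν (Fin.cons x y) * f (simplexPoint (Fin.cons x y)) :=
      ((measurable_dirichletDensity ν).mul (hf.comp measurable_simplexPoint)).comp
        (measurable_cons.comp measurable_prodMk_left)
    have hcons : Measurable fun z : Fin (n + 1) → ℝ => f (Fin.cons x ((1 - x) • z)) :=
      hf.comp (measurable_cons_smul.comp measurable_prodMk_left)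
    rw [lintegral_eq_mul_lintegral_smul (sub_pos.2 hx.2) hdensity, lintegral_dirichlet _ hcons,
      ← lintegral_const_mul' (ENNReal.ofReal ((1 - x) ^ n)) _ ENNReal.ofReal_ne_top,
      ← lintegral_const_mul' (betaPDF _ _ x) _ ENNReal.ofReal_ne_top]
    refine lintegral_congr fun y => ?_
    rw [← mul_assoc, ← mul_assoc, ← dirichletDensity_cons hν hx, simplexPoint_cons]
  · have hIcc : x ∉ Set.Icc (0 : ℝ) 1 := fun h =>
      hx ⟨h.1.lt_of_ne hx0.symm, h.2.lt_of_ne hx1⟩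
    have hzero (y : Fin n → ℝ) : dirichletDensity ν (Fin.cons x y) = 0 :=
      Set.indicator_of_notMem (fun h => hIcc (mem_Icc_of_cons_mem_cornerSimplex h)) _
    simp only [hzero, zero_mul, lintegral_zero, betaPDF_eq, if_neg (mt Set.mem_Ioo.2 hx),
      ENNReal.ofReal_zero]

instance (ν : Fin (n + 1) → ℝ) : SFinite (dirichlet (n + 1) ν) := by
  rw [dirichlet_succ]
  infer_instance

theorem dirichlet_eq_map_prod {ν : Fin (n + 2) → ℝ} (hν : ∀ k, 0 < ν k) :
    dirichlet (n + 2) ν =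
      ((betaMeasure (ν 0) (∑ k, Fin.tail ν k)).prod (dirichlet (n + 1) (Fin.tail ν))).map
        (fun p => Fin.cons p.1 ((1 - p.1) • p.2)) := by
  refine Measure.ext_of_lintegral _ fun f hf => ?_
  have hcons := hf.comp (measurable_cons_smul (n := n + 1))
  rw [lintegral_map hf measurable_cons_smul, lintegral_prod _ (by exact hcons.aemeasurable),
    betaMeasure, lintegral_withDensity_eq_lintegral_mul _ (measurable_betaPDF _ _)
      (by exact hcons.lintegral_prod_right'), lintegral_dirichlet ν hf,
    lintegral_eq_lintegral_lintegral_cons (by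
      exact (measurable_dirichletDensity ν).mul (hf.comp measurable_simplexPoint))]
  refine lintegral_congr_ae ?_
  filter_upwards [Measure.ae_ne volume 0, Measure.ae_ne volume 1] with x hx0 hx1
  exact lintegral_dirichletDensity_cons hν hx0 hx1 hf

theorem dirichlet_one {ν : Fin 1 → ℝ} (hν : 0 < ν 0) :
    dirichlet 1 ν = Measure.dirac 1 := by
  have hpoint (x : Fin 0 → ℝ) : simplexPoint x = 1 := by
    ext k
    rw [Subsingleton.elim (α := Fin 1) k (Fin.last 0), simplexPoint_last, Fin.sum_univ_zero,
      sub_zero, Pi.one_apply]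
  have hdensity (x : Fin 0 → ℝ) : dirichletDensity ν x = 1 := by
    rw [dirichletDensity, Set.indicator_of_mem (by simp [cornerSimplex]), hpoint]
    simp [(Real.Gamma_pos_of_pos hν).ne']
  refine Measure.ext_of_lintegral _ fun f hf => ?_
  simp [lintegral_dirichlet ν hf, lintegral_dirac' _ hf, hpoint, hdensity, volume_pi]

theorem isProbabilityMeasure_dirichlet {ν : Fin (n + 1) → ℝ} (hν : ∀ k, 0 < ν k) :
    IsProbabilityMeasure (dirichlet (n + 1) ν) := by
  induction n with
  | zero => exact dirichlet_one (hν 0) ▸ Measure.dirac.isProbabilityMeasure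
  | succ n ih =>
    have := ih (ν := Fin.tail ν) fun k => hν k.succ
    have := isProbabilityMeasureBeta (hν 0) (sum_tail_pos hν)
    rw [dirichlet_eq_map_prod hν]
    exact Measure.isProbabilityMeasure_map measurable_cons_smul.aemeasurable

end Dirichlet

section RandomWeights

variable {ι : Type*} [Fintype ι] {μ : ι → Measure ℝ}

theorem integral_cexp_sum_mul_pi [∀ k, SigmaFinite (μ k)] (t : ℝ) (z : ι → ℝ) :
    ∫ w, Complex.exp (t * ((∑ k, z k * w k : ℝ) : ℂ) * Complex.I) ∂(Measure.pi μ) =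
      ∏ k, charFun (μ k) (t * z k) := by
  simp only [charFun_apply_real]
  rw [← integral_fintype_prod_eq_prod]
  refine integral_congr_ae (.of_forall fun w => ?_)
  simp only [← Complex.exp_sum]
  congr 1
  push_cast
  rw [Finset.mul_sum, Finset.sum_mul]
  exact Finset.sum_congr rfl fun k _ => by ring

theorem charFun_map_sum_mul {Ω 𝓧 : Type*} [MeasurableSpace Ω] [MeasurableSpace 𝓧] {P : Measure Ω}
    [IsProbabilityMeasure P] {Z : Ω → 𝓧} {W : ι → Ω → ℝ} {ζ : Measure 𝓧} {f : 𝓧 → ι → ℝ}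
    (hf : Measurable f) (hZ : HasLaw Z ζ P) (hW : ∀ k, HasLaw (W k) (μ k) P)
    (hind : iIndepFun W P) (hZW : IndepFun Z (fun ω k => W k ω) P) (t : ℝ) :
    charFun (P.map fun ω => ∑ k, f (Z ω) k * W k ω) t =
      ∫ z, ∏ k, charFun (μ k) (t * f z k) ∂ζ := by
  have (k : ι) : IsProbabilityMeasure (μ k) := (hW k).isProbabilityMeasure_iff.1 inferInstance
  have : IsProbabilityMeasure ζ := hZ.isProbabilityMeasure_iff.1 inferInstance
  have hjoint := hZW.hasLaw_prod hZ (iIndepFun.hasLaw_pi hW hind)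
  have hsum : Measurable fun p : 𝓧 × (ι → ℝ) => ∑ k, f p.1 k * p.2 k := by fun_prop
  have hexp : Measurable fun p : 𝓧 × (ι → ℝ) =>
      Complex.exp (t * ((∑ k, f p.1 k * p.2 k : ℝ) : ℂ) * Complex.I) := by fun_prop
  have hmeas : AEMeasurable (fun ω => ∑ k, f (Z ω) k * W k ω) P :=
    hsum.comp_aemeasurable hjoint.aemeasurable
  rw [charFun_apply_real, integral_map hmeas (by fun_prop)]
  refine (hjoint.integral_comp hexp.aestronglyMeasurable).trans ?_
  rw [integral_prod]
  · simp only [integral_cexp_sum_mul_pi]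
  · refine .of_bound hexp.aestronglyMeasurable 1 (.of_forall fun p => ?_)
    rw [← Complex.ofReal_mul, Complex.norm_exp_ofReal_mul_I]

end RandomWeights

section Decomposition

variable {a b c d n : ℕ}

theorem measurable_prod_charFun {ι : Type*} [Fintype ι] (μ : ι → Measure ℝ)
    [∀ k, IsFiniteMeasure (μ k)] (t s : ℝ) :
    Measurable fun z : ι → ℝ => ∏ k, charFun (μ k) (t * z k ^ s) :=
  Finset.measurable_fun_prod _ fun _ _ => measurable_charFun.comp (by fun_prop)

theorem norm_prod_charFun_le_one {ι : Type*} [Fintype ι] (μ : ι → Measure ℝ)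
    [∀ k, IsProbabilityMeasure (μ k)] (x : ι → ℝ) : ‖∏ k, charFun (μ k) (x k)‖ ≤ 1 := by
  rw [norm_prod]
  exact Finset.prod_le_one (fun _ _ => norm_nonneg _) fun _ _ => norm_charFun_le_one _

theorem integral_prod_charFun_dirichlet_succ {ν : Fin (n + 2) → ℝ} (hν : ∀ k, 0 < ν k)
    (μ : Fin (n + 2) → Measure ℝ) [∀ k, IsProbabilityMeasure (μ k)] (t s : ℝ) :
    ∫ z, ∏ k, charFun (μ k) (t * z k ^ s) ∂(dirichlet (n + 2) ν) =
      ∫ x, charFun (μ 0) (t * x ^ s) *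
        ∫ z, ∏ k, charFun (Fin.tail μ k) (t * (1 - x) ^ s * z k ^ s)
          ∂(dirichlet (n + 1) (Fin.tail ν))
        ∂(betaMeasure (ν 0) (∑ k, Fin.tail ν k)) := by
  have := isProbabilityMeasure_dirichlet (ν := Fin.tail ν) fun k => hν k.succ
  have := isProbabilityMeasureBeta (hν 0) (sum_tail_pos hν)
  have hmeas := measurable_prod_charFun μ t s
  rw [dirichlet_eq_map_prod hν, integral_map measurable_cons_smul.aemeasurable
    hmeas.aestronglyMeasurable, integral_prod]
  · refine integral_congr_ae ?_
    filter_upwards [ae_betaMeasure_mem_Ioo (ν 0) (∑ k, Fin.tail ν k)] with x hx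
    rw [← integral_const_mul]
    refine integral_congr_ae ?_
    filter_upwards [ae_dirichlet_nonneg (Fin.tail ν)] with z hz
    simp only [Fin.prod_univ_succ (n := n + 1), Fin.cons_zero, Fin.cons_succ, Pi.smul_apply,
      smul_eq_mul, Fin.tail, Real.mul_rpow (sub_nonneg.2 hx.2.le) (hz _), mul_assoc]
  · exact .of_bound (hmeas.comp measurable_cons_smul).aestronglyMeasurable 1
      (.of_forall fun p => norm_prod_charFun_le_one μ _)

theorem IsLarge.integral_prod_charFun_dirichlet (h : IsLarge a b c d) {v : Fin (n + 1) → ℕ × ℕ}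
    (hv : ∀ k, v k ≠ 0) (t : ℝ) :
    ∫ z, ∏ k, charFun (limitLaw a b c d (v k).1 (v k).2) (t * z k ^ ratio a b c)
        ∂(dirichlet (n + 1) fun k => mass a b (v k)) =
      charFun (limitLaw a b c d (∑ k, v k).1 (∑ k, v k).2) t := by
  induction n generalizing t with
  | zero =>
    rw [dirichlet_one (h.isBalanced.mass_pos (hv 0)), integral_dirac]
    simp
  | succ n ih =>
    have (k : Fin (n + 2)) : IsProbabilityMeasure (limitLaw a b c d (v k).1 (v k).2) :=
      h.isProbabilityMeasure_limitLaw (hv k)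
    have htail : ∑ k, Fin.tail v k ≠ 0 :=
      Fin.sum_univ_succ (Fin.tail v) ▸ add_ne_zero_of_left (hv 1) _
    have hsum : ∑ k, v k = v 0 + ∑ k, Fin.tail v k := Fin.sum_univ_succ v
    rw [integral_prod_charFun_dirichlet_succ fun k => h.isBalanced.mass_pos (hv k), hsum,
      h.limitLaw_add (hv 0) htail, h.charFun_splitLaw (hv 0) htail, map_sum]
    exact integral_congr_ae (.of_forall fun x => by
      exact congrArg _ (ih (v := Fin.tail v) (fun k => hv k.succ) _))

theorem IsLarge.hasLaw_sum_rpow_mul (h : IsLarge a b c d) (hn : n ≠ 0) {v : Fin n → ℕ × ℕ}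
    (hv : ∀ k, v k ≠ 0) {Ω : Type*} [MeasurableSpace Ω] {P : Measure Ω} [IsProbabilityMeasure P]
    {Z : Ω → Fin n → ℝ} {W : Fin n → Ω → ℝ}
    (hZ : HasLaw Z (dirichlet n fun k => mass a b (v k)) P)
    (hW : ∀ k, HasLaw (W k) (limitLaw a b c d (v k).1 (v k).2) P)
    (hind : iIndepFun W P) (hZW : IndepFun Z (fun ω k => W k ω) P) :
    HasLaw (fun ω => ∑ k, Z ω k ^ ratio a b c * W k ω)
      (limitLaw a b c d (∑ k, v k).1 (∑ k, v k).2) P := by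
  obtain ⟨n, rfl⟩ := Nat.exists_eq_succ_of_ne_zero hn
  have hmeas : AEMeasurable (fun ω => ∑ k, Z ω k ^ ratio a b c * W k ω) P :=
    Finset.aemeasurable_fun_sum _ fun k _ =>
      (((measurable_pi_apply k).comp_aemeasurable hZ.aemeasurable).pow_const _).mul
        (hW k).aemeasurable
  refine ⟨hmeas, Measure.ext_of_charFun (funext fun t => ?_)⟩
  rw [← h.integral_prod_charFun_dirichlet hv]
  exact charFun_map_sum_mul (f := fun z k => z k ^ ratio a b c) (by fun_prop) hZ hW hind hZW t

end Decomposition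

end PolyaUrn

theorem mainTheorem8_general (a b c d : ℕ) (hbal : a + b = c + d)
    (hlarge : 1 / 2 < PolyaUrn.ratio a b c) :
    (∀ α β : ℕ, (α, β) ≠ (0, 0) → ∀ᵐ U ∂(PolyaUrn.urnLaw a b c d α β),
      ∃ w : ℝ, Tendsto (PolyaUrn.scaled a b c U) atTop (𝓝 w)) ∧
    (∀ α β : ℕ, (α, β) ≠ (0, 0) →
      ∀ (Ω : Type*) [MeasurableSpace Ω] (P : Measure Ω) [IsProbabilityMeasure P]
        (Z : Ω → Fin (α + β) → ℝ) (W : Fin (α + β) → Ω → ℝ),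
        HasLaw Z (PolyaUrn.dirichlet (α + β) (fun _ => 1 / ((a : ℝ) + b))) P →
        (∀ i : Fin α, HasLaw (W (Fin.castAdd β i)) (PolyaUrn.limitLaw a b c d 1 0) P) →
        (∀ j : Fin β, HasLaw (W (Fin.natAdd α j)) (PolyaUrn.limitLaw a b c d 0 1) P) →
        iIndepFun W P →
        IndepFun Z (fun ω k => W k ω) P →
        HasLaw
          (fun ω =>
            ∑ i : Fin α, Z ω (Fin.castAdd β i) ^ PolyaUrn.ratio a b c * W (Fin.castAdd β i) ω
            + ∑ j : Fin β, Z ω (Fin.natAdd α j) ^ PolyaUrn.ratio a b c * W (Fin.natAdd α j) ω)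
          (PolyaUrn.limitLaw a b c d α β) P) := by
  have h : PolyaUrn.IsLarge a b c d := ⟨hbal, hlarge⟩
  refine ⟨fun α β hαβ => h.ae_exists_tendsto_scaled (v := (α, β)) hαβ, ?_⟩
  intro α β hαβ Ω _ P _ Z W hZ hred hblack hind hZW
  set v : Fin (α + β) → ℕ × ℕ := Fin.append (fun _ => (1, 0)) (fun _ => (0, 1)) with hv
  have hne (k) : v k ≠ 0 := by
    cases k using Fin.addCases <;> simp [hv]
  have hmass (k) : PolyaUrn.mass a b (v k) = 1 / ((a : ℝ) + b) := by
    cases k using Fin.addCases <;> simp [hv, PolyaUrn.mass_apply]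
  have hsum : ∑ k, v k = (α, β) := by
    rw [Fin.sum_univ_add]
    simp [hv]
  have hW (k) : HasLaw (W k) (PolyaUrn.limitLaw a b c d (v k).1 (v k).2) P := by
    cases k using Fin.addCases with
    | left i => simpa [hv] using hred i
    | right j => simpa [hv] using hblack j
  have hcard : α + β ≠ 0 := by
    simpa [Nat.add_eq_zero_iff, Prod.ext_iff] using hαβ
  simpa only [hsum, Fin.sum_univ_add] using
    h.hasLaw_sum_rpow_mul hcard hne (by simpa only [hmass] using hZ) hW hind hZW

theorem mainTheorem8 (a b c d : ℕ) (hbal : a + b = c + d) (hbc : b * c ≠ 0)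
    (hlarge : 1 / 2 < PolyaUrn.ratio a b c) :
    (∀ α β : ℕ, (α, β) ≠ (0, 0) → ∀ᵐ U ∂(PolyaUrn.urnLaw a b c d α β),
      ∃ w : ℝ, Tendsto (PolyaUrn.scaled a b c U) atTop (𝓝 w)) ∧
    (∀ α β : ℕ, (α, β) ≠ (0, 0) →
      ∀ (Ω : Type*) [MeasurableSpace Ω] (P : Measure Ω) [IsProbabilityMeasure P]
        (Z : Ω → Fin (α + β) → ℝ) (W : Fin (α + β) → Ω → ℝ),
        HasLaw Z (PolyaUrn.dirichlet (α + β) (fun _ => 1 / ((a : ℝ) + b))) P →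
        (∀ i : Fin α, HasLaw (W (Fin.castAdd β i)) (PolyaUrn.limitLaw a b c d 1 0) P) →
        (∀ j : Fin β, HasLaw (W (Fin.natAdd α j)) (PolyaUrn.limitLaw a b c d 0 1) P) →
        iIndepFun W P →
        IndepFun Z (fun ω k => W k ω) P →
        HasLaw
          (fun ω =>
            ∑ i : Fin α, Z ω (Fin.castAdd β i) ^ PolyaUrn.ratio a b c * W (Fin.castAdd β i) ω
            + ∑ j : Fin β, Z ω (Fin.natAdd α j) ^ PolyaUrn.ratio a b c * W (Fin.natAdd α j) ω)
          (PolyaUrn.limitLaw a b c d α β) P) :=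
  mainTheorem8_general a b c d hbal hlarge
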